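/- **Theorem.** Let $M$ be a closed connected smooth manifold, let $G$ be a topological group, and let $\pi : P \to B$ be a universal principal $G$-bundle, that is, a locally trivial principal $G$-bundle with contractible total space $P$, over a paracompact Hausdorff space $B$ which is homotopy equivalent to $M$ (for example $B = M$). Let $\mathcal{G}(P)$ be its gauge group, the group of $G$-equivariant homeomorphisms of $P$ covering the identity map of $B$. Let $LM$ be the space of free loops $\gamma : [0,1] \to M$, $\gamma(0) = \gamma(1)$, let $e : LM \to M$ be the evaluation fibration $e(\gamma) = \gamma(0)$, and let $\Gamma_M(LM)$ be the space of continuous sections of $e$. Let $HE(M)$ be the monoid of self homotopy equivalences of $M$, with the identity map as base point, and let $\Omega HE(M)$ be the space of loops in $HE(M)$ at this base point. All these spaces carry the compact-open topology. Then there are homotopy equivalences $$\mathcal{G}(P) \simeq \Gamma_M(LM) \qquad\text{and}\qquad \mathcal{G}(P) \simeq \Omega HE(M).$$ -/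

import Mathlib

open scoped Manifold ContDiff unitInterval RightActions Topology.Homotopy ContinuousMap

/-- `π : P → B` is a (locally trivial) principal `G`-bundle: `G` acts continuously on `P` from the
right (a right action is an action of the opposite group `Gᵐᵒᵖ`, written `p <• g`), the action
preserves the fibres of `π`, and every point of `B` has an open neighbourhood `U` with a
homeomorphism `π ⁻¹ U ≃ U × G` over `U` that is equivariant for right multiplication on `G`. -/
structure IsPrincipalBundle (G : Type*) [Group G] [TopologicalSpace G]
    {P : Type*} [TopologicalSpace P] [MulAction Gᵐᵒᵖ P]
    {B : Type*} [TopologicalSpace B] (π : P → B) : Prop where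
  continuous_smul : Continuous fun x : P × G => x.1 <• x.2
  proj_smul : ∀ (p : P) (g : G), π (p <• g) = π p
  locally_trivial : ∀ b : B, ∃ e : Bundle.Trivialization G π, b ∈ e.baseSet ∧
    ∀ p : P, π p ∈ e.baseSet → ∀ g : G, e (p <• g) = ((e p).1, (e p).2 * g)

/-- The gauge group of a bundle `π : P → B` with a right action of `G` on `P`: the group of
`G`-equivariant homeomorphisms of `P` that cover the identity map of `B`. -/
def gaugeGroup (G : Type*) [Group G] {P : Type*} [TopologicalSpace P] [MulAction Gᵐᵒᵖ P]
    {B : Type*} (π : P → B) : Subgroup (P ≃ₜ P) where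
  carrier := {φ | (∀ (p : P) (g : G), φ (p <• g) = φ p <• g) ∧ ∀ p : P, π (φ p) = π p}
  one_mem' := ⟨fun _ _ => rfl, fun _ => rfl⟩
  mul_mem' := by
    rintro φ ψ ⟨h₁, h₂⟩ ⟨k₁, k₂⟩
    refine ⟨fun p g => ?_, fun p => ?_⟩
    · change φ (ψ _) = φ (ψ p) <• g
      rw [k₁, h₁]
    · change π (φ (ψ p)) = π p
      rw [h₂, k₂]
  inv_mem' := by
    rintro φ ⟨h₁, h₂⟩
    refine ⟨fun p g => ?_, fun p => ?_⟩
    · change φ.symm _ = φ.symm p <• g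
      rw [Homeomorph.symm_apply_eq, h₁, Homeomorph.apply_symm_apply]
    · change π (φ.symm p) = π p
      rw [← h₂ (φ.symm p), Homeomorph.apply_symm_apply]

/-- The topology of the gauge group is the compact-open topology of `C(P, P)`. -/
instance gaugeGroup.instTopologicalSpace (G : Type*) [Group G] {P : Type*} [TopologicalSpace P]
    [MulAction Gᵐᵒᵖ P] {B : Type*} (π : P → B) : TopologicalSpace (gaugeGroup G π) :=
  TopologicalSpace.induced (fun φ => ((φ : P ≃ₜ P) : C(P, P))) ContinuousMap.compactOpen

/-- The free loop space `LM`: continuous closed paths `γ : [0, 1] → M`, `γ 0 = γ 1`, with the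
compact-open topology. -/
abbrev FreeLoopSpace (M : Type*) [TopologicalSpace M] : Type _ :=
  {γ : C(I, M) // γ 0 = γ 1}

/-- The evaluation fibration `e : LM → M`, `e γ = γ 0`. -/
def FreeLoopSpace.eval (M : Type*) [TopologicalSpace M] (γ : FreeLoopSpace M) : M :=
  γ.1 0

/-- The space of continuous sections of a map `e : E → B`, with the compact-open topology. -/
abbrev SectionSpace {E B : Type*} [TopologicalSpace E] [TopologicalSpace B] (e : E → B) : Type _ :=
  {s : C(B, E) // ∀ b : B, e (s b) = b}

/-- `HE(M)`: the space of continuous maps `f : M → M` that are homotopy equivalences, with the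
compact-open topology. -/
abbrev HomotopySelfEquiv (M : Type*) [TopologicalSpace M] : Type _ :=
  {f : C(M, M) // ∃ h : M ≃ₕ M, h.toFun = f}

/-- `HE(M)` is a monoid under composition; its unit, which is also its base point, is the identity
map of `M`. -/
instance HomotopySelfEquiv.instMonoid (M : Type*) [TopologicalSpace M] :
    Monoid (HomotopySelfEquiv M) where
  one := ⟨ContinuousMap.id M, ContinuousMap.HomotopyEquiv.refl M, rfl⟩
  mul f g := ⟨f.1.comp g.1, by
    obtain ⟨h, hh⟩ := f.2
    obtain ⟨k, hk⟩ := g.2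
    exact ⟨k.trans h, by rw [← hh, ← hk]; rfl⟩⟩
  mul_assoc _ _ _ := rfl
  one_mul _ := rfl
  mul_one _ := rfl

/-! ### Principal bundles through difference functions and local sections -/

open Set Filter Topology

/-! A gauge transformation is a section of the bundle of groups Ad(P), with fibre `G`. For a
universal bundle over `M` the fibre is equivalent to the based loop space, and fibrewise Ad(P)
becomes the free loop fibration. The proof makes this explicit. For a universal bundle `ρ : Q → M`,
equivariance and contractibility of `Q` give paths from `q` to `q'` that are natural under the
diagonal action (`exists_equivariant_contraction`). Projecting the path from `q` to `φ q` gives a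
loop at `ρ q` that depends on `ρ q` only, so `φ` yields a section of `LM → M`. Conversely a section
`s` acts on `Q` by the holonomy of its loops, by equivariant path lifting (`exists_path_lifting`).
The two constructions are homotopy inverse.

Both tools come from one local-to-global principle in the manner of Dold,
`exists_vertical_contraction`: local vertical contractions over a paracompact space are cut off by
bump functions and composed. It also yields the covering homotopy theorem. With that theorem the
bundle over `B` is exchanged for its pullback to `M`, which is again universal and has equivalent
gauge maps (`exists_pullback_homotopyEquiv`).

Sections of `LM → M` are loops in `C(M, M)` at the identity by the exponential law, and every point
of such a loop is homotopic to the identity. This turns the first equivalence into the second. -/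

theorem smul_smul_mul {G P : Type*} [Group G] [MulAction Gᵐᵒᵖ P] (p : P) (g h : G) :
    p <• g <• h = p <• (g * h) := by
  rw [MulOpposite.op_mul, mul_smul]

/-- A free and continuous right action of `G` on `P` whose orbits are the fibres of `π`, with
continuous difference function on `P ×_B P` and with local sections. -/
structure IsPrincipalMap (G : Type*) [Group G] [TopologicalSpace G]
    {P : Type*} [TopologicalSpace P] [MulAction Gᵐᵒᵖ P]
    {B : Type*} [TopologicalSpace B] (π : P → B) : Prop where
  continuous_smul : Continuous fun x : P × G => x.1 <• x.2
  proj_smul : ∀ (p : P) (g : G), π (p <• g) = π p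
  continuous_proj : Continuous π
  free : ∀ (p : P) (g h : G), p <• g = p <• h → g = h
  exists_diff : ∃ d : P → P → G, (∀ p q, π p = π q → p <• d p q = q) ∧
    ContinuousOn (fun x : P × P => d x.1 x.2) {x | π x.1 = π x.2}
  exists_section : ∀ b, ∃ (U : Set B) (s : B → P), IsOpen U ∧ b ∈ U ∧ ContinuousOn s U ∧
    ∀ x ∈ U, π (s x) = x

namespace IsPrincipalMap

variable {G : Type*} [Group G] [TopologicalSpace G] {P : Type*} [TopologicalSpace P]
  [MulAction Gᵐᵒᵖ P] {B : Type*} [TopologicalSpace B] {π : P → B}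

/-- The element of `G` that carries `p` to `q`, for `p` and `q` in one fibre. -/
noncomputable def diff (hπ : IsPrincipalMap G π) (p q : P) : G := hπ.exists_diff.choose p q

theorem smul_diff (hπ : IsPrincipalMap G π) {p q : P} (h : π p = π q) : p <• hπ.diff p q = q :=
  hπ.exists_diff.choose_spec.1 p q h

theorem diff_smul_self (hπ : IsPrincipalMap G π) (p : P) (g : G) : hπ.diff p (p <• g) = g :=
  hπ.free p _ _ (hπ.smul_diff (hπ.proj_smul p g).symm)

theorem diff_self (hπ : IsPrincipalMap G π) (p : P) : hπ.diff p p = 1 := by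
  simpa using hπ.diff_smul_self p 1

theorem diff_smul_right (hπ : IsPrincipalMap G π) {p q : P} (h : π p = π q) (g : G) :
    hπ.diff p (q <• g) = hπ.diff p q * g := by
  conv_lhs => rw [← hπ.smul_diff h, smul_smul_mul, hπ.diff_smul_self]

theorem diff_smul_left (hπ : IsPrincipalMap G π) {p q : P} (h : π p = π q) (g : G) :
    hπ.diff (p <• g) q = g⁻¹ * hπ.diff p q := by
  refine hπ.free (p <• g) _ _ ?_
  rw [hπ.smul_diff (by rw [hπ.proj_smul, h]), smul_smul_mul, mul_inv_cancel_left, hπ.smul_diff h]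

theorem diff_smul_smul (hπ : IsPrincipalMap G π) {p q : P} (h : π p = π q) (g : G) :
    hπ.diff (p <• g) (q <• g) = g⁻¹ * hπ.diff p q * g := by
  rw [hπ.diff_smul_right (by rw [hπ.proj_smul, h]), hπ.diff_smul_left h]

theorem smul_diff_smul_smul (hπ : IsPrincipalMap G π) {Y : Type*}
    [MulAction Gᵐᵒᵖ Y] (y : Y)
    {p q : P} (h : π p = π q) (g : G) :
    y <• g <• hπ.diff (p <• g) (q <• g) = y <• hπ.diff p q <• g := by
  rw [hπ.diff_smul_smul h, smul_smul_mul, smul_smul_mul, mul_assoc, mul_inv_cancel_left]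

theorem continuous_diff (hπ : IsPrincipalMap G π) {X : Type*} [TopologicalSpace X] {f g : X → P}
    (hf : Continuous f) (hg : Continuous g) (h : ∀ x, π (f x) = π (g x)) :
    Continuous fun x => hπ.diff (f x) (g x) :=
  hπ.exists_diff.choose_spec.2.comp_continuous (hf.prodMk hg) h

theorem continuous_act (hπ : IsPrincipalMap G π) {X : Type*} [TopologicalSpace X] {f : X → P}
    {g : X → G} (hf : Continuous f) (hg : Continuous g) : Continuous fun x => f x <• g x :=
  hπ.continuous_smul.comp (hf.prodMk hg)

theorem surjective (hπ : IsPrincipalMap G π) : Function.Surjective π := fun b => by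
  obtain ⟨U, s, -, hb, -, hs⟩ := hπ.exists_section b
  exact ⟨s b, hs b hb⟩

/-- Translating a local section by a constant of `G` makes it pass through any prescribed point of
`P`. -/
theorem isOpenMap (hπ : IsPrincipalMap G π) : IsOpenMap π := by
  rw [isOpenMap_iff_nhds_le]
  intro p
  obtain ⟨U, s, hU, hb, hsc, hs⟩ := hπ.exists_section (π p)
  set g := hπ.diff (s (π p)) p
  have hg : s (π p) <• g = p := hπ.smul_diff (hs _ hb)
  have hc : ContinuousAt (fun b => s b <• g) (π p) := by
    have : Continuous fun q : P => q <• g := hπ.continuous_act continuous_id continuous_const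
    exact this.continuousAt.comp (hsc.continuousAt (hU.mem_nhds hb))
  have h1 : Tendsto (fun b => s b <• g) (𝓝 (π p)) (𝓝 p) := by
    have := hc.tendsto
    simpa only [hg] using this
  have h2 : (fun b => π (s b <• g)) =ᶠ[𝓝 (π p)] id := by
    filter_upwards [hU.mem_nhds hb] with b hb
    rw [hπ.proj_smul, hs b hb, id]
  calc 𝓝 (π p) = map (fun b => π (s b <• g)) (𝓝 (π p)) := by rw [map_congr h2, map_id]
    _ = map π (map (fun b => s b <• g) (𝓝 (π p))) := by rw [map_map]; rfl
    _ ≤ map π (𝓝 p) := map_mono h1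

/-- An invariant continuous function on `Z × P × I` descends to `Z × B × I`. -/
theorem exists_descend (hπ : IsPrincipalMap G π) {Z W : Type*} [TopologicalSpace Z]
    [TopologicalSpace W] (k : Z × P × I → W) (hk : Continuous k)
    (hinv : ∀ z (p : P) (g : G) t, k (z, p <• g, t) = k (z, p, t)) :
    ∃ l : Z × B × I → W, Continuous l ∧ ∀ z p t, l (z, π p, t) = k (z, p, t) := by
  let l : Z × B × I → W := fun x => k (x.1, Function.surjInv hπ.surjective x.2.1, x.2.2)
  have hl : ∀ z p t, l (z, π p, t) = k (z, p, t) := fun z p t => by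
    have h := hπ.smul_diff (Function.surjInv_eq hπ.surjective (π p))
    change k (z, Function.surjInv hπ.surjective (π p), t) = _
    rw [← hinv z _ (hπ.diff (Function.surjInv hπ.surjective (π p)) p), h]
  refine ⟨l, ?_, hl⟩
  -- An open surjection stays a quotient map after products with identities, with no local
  -- compactness of the factors.
  have hq : IsQuotientMap (Prod.map id (Prod.map π id) : Z × P × I → Z × B × I) := by
    refine IsOpenMap.isQuotientMap ?_ ?_ ?_
    · exact IsOpenMap.id.prodMap (hπ.isOpenMap.prodMap IsOpenMap.id)
    · exact continuous_id.prodMap (hπ.continuous_proj.prodMap continuous_id)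
    · exact Function.surjective_id.prodMap (hπ.surjective.prodMap Function.surjective_id)
  rw [hq.continuous_iff]
  exact hk.congr fun x => (hl _ _ _).symm

end IsPrincipalMap

theorem IsPrincipalBundle.isPrincipalMap {G : Type*} [Group G] [TopologicalSpace G]
    [IsTopologicalGroup G] {P : Type*} [TopologicalSpace P]
    [MulAction Gᵐᵒᵖ P] {B : Type*} [TopologicalSpace B] {π : P → B}
    (hπ : IsPrincipalBundle G π) : IsPrincipalMap G π := by
  have hfree : ∀ (p : P) (g h : G), p <• g = p <• h → g = h := fun p g h hgh => by
    obtain ⟨e, he, hg⟩ := hπ.locally_trivial (π p)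
    have := congrArg (fun q => (e q).2) hgh
    simpa [hg p he] using this
  have hd : ∀ (e : Bundle.Trivialization G π), (∀ p : P, π p ∈ e.baseSet → ∀ g : G,
      e (p <• g) = ((e p).1, (e p).2 * g)) → ∀ p q, π p ∈ e.baseSet → π p = π q →
      p <• ((e p).2⁻¹ * (e q).2) = q := fun e he p q hp hpq => by
    have hp' : p ∈ e.source := e.mem_source.2 hp
    have hq' : q ∈ e.source := e.mem_source.2 (hpq ▸ hp)
    refine e.injOn (e.mem_source.2 (by rwa [hπ.proj_smul])) hq' ?_
    change e _ = e _
    rw [he p hp, mul_inv_cancel_left, e.coe_fst hp', hpq, ← e.coe_fst hq']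
  choose e hb he using hπ.locally_trivial
  have hproj : Continuous π := continuous_iff_continuousAt.2 fun p =>
    (e (π p)).continuousAt_proj ((e (π p)).mem_source.2 (hb _))
  refine ⟨hπ.continuous_smul, hπ.proj_smul, hproj, hfree,
    ⟨fun p q => (e (π p) p).2⁻¹ * (e (π p) q).2, fun p q h => hd _ (he _) p q (hb _) h, ?_⟩, ?_⟩
  -- The trivialization that defines the difference changes with `p`. By freeness the fixed one at
  -- `π p₀` gives the same value nearby.
  · rintro ⟨p₀, q₀⟩ (h₀ : π p₀ = π q₀)
    have hc : ∀ r, π r = π p₀ → ContinuousAt (fun q => (e (π p₀) q).2) r := fun r hr =>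
      ((e (π p₀)).continuousAt ((e (π p₀)).mem_source.2 (hr ▸ hb _))).snd
    have h1 : ContinuousAt (fun x : P × P => (e (π p₀) x.1).2⁻¹ * (e (π p₀) x.2).2) (p₀, q₀) :=
      ((hc p₀ rfl).comp (f := Prod.fst) (x := (p₀, q₀)) continuousAt_fst).inv.mul
        ((hc q₀ h₀.symm).comp (f := Prod.snd) (x := (p₀, q₀)) continuousAt_snd)
    refine h1.continuousWithinAt.congr_of_eventuallyEq ?_ rfl
    have hU : ∀ᶠ x : P × P in 𝓝 (p₀, q₀), π x.1 ∈ (e (π p₀)).baseSet :=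
      (hproj.comp continuous_fst).continuousAt.eventually
        ((e (π p₀)).open_baseSet.mem_nhds (hb _))
    filter_upwards [mem_nhdsWithin_of_mem_nhds hU, self_mem_nhdsWithin] with x hx hx'
    exact hfree x.1 _ _ ((hd _ (he _) _ _ (hb _) hx').trans (hd _ (he _) _ _ hx hx').symm)
  · intro b
    refine ⟨(e b).baseSet, fun x => (e b).toOpenPartialHomeomorph.symm (x, 1),
      (e b).open_baseSet, hb b, ?_, fun x hx => (e b).proj_symm_apply' hx⟩
    exact (e b).toOpenPartialHomeomorph.symm.continuousOn.comp (by fun_prop)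
      fun x hx => (e b).mem_target.2 hx

/-! ### From local to global vertical contractions -/

section OrderedComposition

variable {ι E X : Type*}

theorem Finset.sort_eq_filter_of_subset [LinearOrder ι] {J K : Finset ι} (h : J ⊆ K) :
    J.sort = K.sort.filter (· ∈ J) := by
  have h1 : (K.sort.filter (· ∈ J)).toFinset = J := by
    ext i
    simp only [List.toFinset_filter, Finset.sort_toFinset, Finset.mem_filter, decide_eq_true_eq]
    exact ⟨fun hi => hi.2, fun hi => ⟨h hi, hi⟩⟩
  have h2 := (List.toFinset_sort (· ≤ ·) ((Finset.sort_nodup K (· ≤ ·)).filter (· ∈ J))).2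
    ((Finset.pairwise_sort K (· ≤ ·)).filter _)
  rw [h1] at h2
  exact h2

/-- Factors that act trivially over `x` may be dropped. Hence a finite index set that varies with
the point can locally be replaced by a constant one. -/
theorem List.foldl_filter_eq_of_fixed {τ : ι → E → E} {q : E → X} (hq : ∀ i e, q (τ i e) = q e)
    (p : ι → Bool) {x : X} (hp : ∀ i, p i = false → ∀ e, q e = x → τ i e = e) (l : List ι) :
    ∀ e, q e = x → (l.filter p).foldl (fun e i => τ i e) e = l.foldl (fun e i => τ i e) e := by
  induction l with
  | nil => intro e _; rfl
  | cons i l ih =>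
    intro e he
    cases h : p i with
    | true =>
      rw [List.filter_cons_of_pos h, List.foldl_cons, List.foldl_cons]
      exact ih _ ((hq i e).trans he)
    | false =>
      rw [List.filter_cons_of_neg (by simp [h]), List.foldl_cons, hp i h e he]
      exact ih e he

theorem List.foldl_invariant {τ : ι → E → E} {q : E → X} (hq : ∀ i e, q (τ i e) = q e)
    (l : List ι) : ∀ e, q (l.foldl (fun e i => τ i e) e) = q e := by
  induction l with
  | nil => intro e; rfl
  | cons i l ih => intro e; rw [List.foldl_cons, ih, hq]

theorem List.foldl_comm_apply {τ : ι → E → E} {a : E → E} {q : E → X}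
    (hq : ∀ i e, q (τ i e) = q e) {x : X} (ha : ∀ i e, q e = x → τ i (a e) = a (τ i e))
    (l : List ι) : ∀ e, q e = x → l.foldl (fun e i => τ i e) (a e) =
      a (l.foldl (fun e i => τ i e) e) := by
  induction l with
  | nil => intro e _; rfl
  | cons i l ih =>
    intro e he
    rw [List.foldl_cons, List.foldl_cons, ha i e he]
    exact ih _ ((hq i e).trans he)

theorem List.foldl_eq_self {τ : ι → E → E} (hτ : ∀ i e, τ i e = e) (l : List ι) (e : E) :
    l.foldl (fun e i => τ i e) e = e := by
  induction l with
  | nil => rfl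
  | cons i l ih => rw [List.foldl_cons, hτ, ih]

theorem continuous_foldl_apply [TopologicalSpace E] {T : Type*} [TopologicalSpace T]
    {τ : ι → T → E → E} (hτ : ∀ i, Continuous fun z : T × E => τ i z.1 z.2) (l : List ι) :
    Continuous fun z : T × E => l.foldl (fun e i => τ i z.1 e) z.2 := by
  induction l with
  | nil => exact continuous_snd
  | cons i l ih => exact ih.comp (continuous_fst.prodMk (hτ i))

end OrderedComposition

/-- A map which over the members of an open cover of a paracompact space contracts vertically to a
section contracts vertically to a section, compatibly with the symmetries of the local
contractions. -/
theorem exists_vertical_contraction {ι X Y E : Type*} [TopologicalSpace X] [T2Space X]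
    [ParacompactSpace X] [TopologicalSpace Y] [TopologicalSpace E] (p : C(E, Y)) (r : C(Y, X))
    (U : ι → Set X) (hU : ∀ i, IsOpen (U i)) (hcov : ∀ x, ∃ i, x ∈ U i)
    (h : ∀ i, C({e : E // r (p e) ∈ U i} × I, E))
    (s : ∀ i, C({y : Y // r y ∈ U i}, E))
    (h_proj : ∀ i e t, p (h i (e, t)) = p e.1)
    (h_zero : ∀ i e, h i (e, 0) = e.1)
    (h_one : ∀ i e, h i (e, 1) = s i ⟨p e.1, e.2⟩)
    (s_proj : ∀ i y, p (s i y) = y.1) :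
    ∃ (D : C(E × I, E)) (S : C(Y, E)), (∀ e t, p (D (e, t)) = p e) ∧ (∀ e, D (e, 0) = e) ∧
      (∀ e, D (e, 1) = S (p e)) ∧ (∀ y, p (S y) = y) ∧
      ∀ a : E → E, (∀ e, r (p (a e)) = r (p e)) →
        (∀ i e (he : r (p e) ∈ U i) (hae : r (p (a e)) ∈ U i) t,
          h i (⟨a e, hae⟩, t) = a (h i (⟨e, he⟩, t))) →
        ∀ e t, D (a e, t) = a (D (e, t)) := by
  classical
  obtain ⟨f, hf⟩ := BumpCovering.exists_isSubordinate isClosed_univ U hU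
    (fun x _ => mem_iUnion.2 (hcov x))
  -- The local contractions need not commute; a fixed order makes their composite well defined.
  let _ : LinearOrder ι := linearOrderOfSTO (WellOrderingRel (α := ι))
  let q : E → X := fun e => r (p e)
  have hqc : Continuous q := r.continuous.comp p.continuous
  have hmem : ∀ i (t : I) e, (t : ℝ) * f i (q e) ∈ I := fun i t e =>
    ⟨mul_nonneg t.2.1 (f.nonneg i _), mul_le_one₀ t.2.2 (f.nonneg i _) (f.le_one i _)⟩
  -- The bump function slows the `i`-th contraction down to rest at the edge of `U i`, so it extends
  -- by the identity.
  let τ : ι → I → E → E := fun i t e =>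
    if he : q e ∈ U i then h i (⟨e, he⟩, ⟨t * f i (q e), hmem i t e⟩) else e
  have τ_pos : ∀ i t e (he : q e ∈ U i),
      τ i t e = h i (⟨e, he⟩, ⟨t * f i (q e), hmem i t e⟩) := fun i t e he => dif_pos he
  have τ_proj : ∀ i t e, p (τ i t e) = p e := fun i t e => by
    by_cases he : q e ∈ U i
    · rw [τ_pos i t e he, h_proj]
    · simp only [τ, dif_neg he]
  have τ_q : ∀ i t e, q (τ i t e) = q e := fun i t e => by simp only [q, τ_proj]
  have τ_triv : ∀ i (t : I) e, (t : ℝ) * f i (q e) = 0 → τ i t e = e := fun i t e h0 => by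
    by_cases he : q e ∈ U i
    · rw [τ_pos i t e he]
      refine Eq.trans ?_ (h_zero i ⟨e, he⟩)
      congr 2
      exact Subtype.ext h0
    · simp only [τ, dif_neg he]
  have τ_cont : ∀ i, Continuous fun z : I × E => τ i z.1 z.2 := fun i => by
    rw [continuous_iff_continuousAt]
    rintro ⟨t, e⟩
    by_cases he : q e ∈ U i
    · have hV : IsOpen {z : I × E | q z.2 ∈ U i} := (hU i).preimage (hqc.comp continuous_snd)
      refine ContinuousOn.continuousAt (s := {z : I × E | q z.2 ∈ U i}) ?_ (hV.mem_nhds he)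
      rw [continuousOn_iff_continuous_domRestrict]
      have h1 : Continuous fun z : {z : I × E // q z.2 ∈ U i} =>
          h i (⟨z.1.2, z.2⟩, ⟨z.1.1 * f i (q z.1.2), hmem i z.1.1 z.1.2⟩) := by
        refine (h i).continuous.comp (Continuous.prodMk (by fun_prop) ?_)
        refine Continuous.subtype_mk ?_ _
        exact (by fun_prop : Continuous fun z : {z : I × E // q z.2 ∈ U i} => (z.1.1 : ℝ)).mul
          ((f i).continuous.comp (hqc.comp (by fun_prop)))
      exact h1.congr fun z => (τ_pos i z.1.1 z.1.2 z.2).symm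
    · have ht : q e ∉ tsupport (f i) := fun h' => he (hf i h')
      have h1 : ∀ᶠ z : I × E in 𝓝 (t, e), τ i z.1 z.2 = z.2 := by
        have : ∀ᶠ z : I × E in 𝓝 (t, e), q z.2 ∈ (tsupport (f i))ᶜ :=
          (hqc.comp continuous_snd).continuousAt.eventually
            ((isClosed_tsupport _).isOpen_compl.mem_nhds ht)
        filter_upwards [this] with z hz
        exact τ_triv i _ _ (by rw [image_eq_zero_of_notMem_tsupport hz, mul_zero])
      exact continuousAt_snd.congr (h1.mono fun z hz => hz.symm)
  let J : X → Finset ι := fun x => (f.point_finite x).toFinset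
  let F : Finset ι → I → E → E := fun K t e => K.sort.foldl (fun e i => τ i t e) e
  have F_cont : ∀ K, Continuous fun z : I × E => F K z.1 z.2 := fun K =>
    continuous_foldl_apply τ_cont _
  have F_eq : ∀ K t e, J (q e) ⊆ K → F (J (q e)) t e = F K t e := fun K t e hK => by
    simp only [F]
    rw [Finset.sort_eq_filter_of_subset hK]
    refine List.foldl_filter_eq_of_fixed (q := q) (fun i e => τ_q i t e) _ (x := q e) ?_ _ _ rfl
    intro i hi e' he'
    refine τ_triv i t e' ?_
    have : i ∉ J (q e) := of_decide_eq_false hi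
    have h0 : f i (q e) = 0 := by simpa [J] using this
    rw [he', h0, mul_zero]
  have hJ : ∀ x₀, ∃ K, ∀ᶠ x in 𝓝 x₀, J x ⊆ K := fun x₀ => by
    obtain ⟨N, hN, hfin⟩ := f.locallyFinite x₀
    refine ⟨hfin.toFinset, ?_⟩
    filter_upwards [hN] with x hx i hi
    have : f i x ≠ 0 := by simpa [J] using hi
    exact hfin.mem_toFinset.2 ⟨x, this, hx⟩
  let D : E × I → E := fun z => F (J (q z.1)) z.2 z.1
  have D_cont : Continuous D := by
    rw [continuous_iff_continuousAt]
    rintro ⟨e, t⟩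
    obtain ⟨K, hK⟩ := hJ (q e)
    have h1 : Continuous fun z : E × I => F K z.2 z.1 :=
      (F_cont K).comp (continuous_snd.prodMk continuous_fst)
    refine h1.continuousAt.congr ?_
    filter_upwards [(hqc.comp continuous_fst).continuousAt.eventually hK] with z hz
    exact (F_eq K z.2 z.1 hz).symm
  have D_proj : ∀ e t, p (D (e, t)) = p e := fun e t =>
    List.foldl_invariant (q := p) (fun i e => τ_proj i t e) _ e
  -- Near `x₀` some `f i` is `1`. At time `1` its factor sends everything in a fibre of `p` to the
  -- value of `s i`, which erases the effect of the earlier factors `l₁`; only the later ones `l`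
  -- remain.
  have key : ∀ x₀, ∃ (i : ι) (K : Finset ι) (l : List ι), ∀ᶠ x in 𝓝 x₀, x ∈ U i ∧ J x ⊆ K ∧
      ∀ e (he : q e ∈ U i), q e = x →
        F K 1 e = l.foldl (fun e i => τ i 1 e) (s i ⟨p e, he⟩) := fun x₀ => by
    have h1 := f.eventuallyEq_one x₀ (mem_univ x₀)
    set i := f.ind x₀ (mem_univ x₀)
    have hi : ∀ x, f i x = 1 → x ∈ U i := fun x hx =>
      hf i (subset_tsupport _ (by rw [Function.mem_support, hx]; exact one_ne_zero))
    obtain ⟨K, hK⟩ := hJ x₀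
    have hiK : i ∈ K := hK.self_of_nhds (by
      have : f i x₀ = 1 := h1.self_of_nhds
      simp [J, this])
    obtain ⟨l₁, l₂, hl⟩ := List.append_of_mem ((Finset.mem_sort (· ≤ ·)).2 hiK)
    refine ⟨i, K, l₂, ?_⟩
    filter_upwards [h1, hK] with x hx hxK
    refine ⟨hi x hx, hxK, fun e he hex => ?_⟩
    simp only [F]
    rw [hl, List.foldl_append, List.foldl_cons]
    congr 1
    set e' := l₁.foldl (fun e i => τ i 1 e) e
    have hpe : p e' = p e := List.foldl_invariant (q := p) (fun i e => τ_proj i 1 e) _ e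
    have hqe : q e' = q e := by simp only [q, hpe]
    have hfe : f i (q e') = 1 := by rw [hqe, hex]; exact hx
    have he' : q e' ∈ U i := hi _ hfe
    rw [τ_pos i 1 e' he']
    have h2 : (⟨(1 : I) * f i (q e'), hmem i 1 e'⟩ : I) = 1 := by
      apply Subtype.ext
      simp [hfe]
    rw [h2, h_one]
    congr 1
    exact Subtype.ext hpe
  have D_fib : ∀ e e', p e = p e' → D (e, 1) = D (e', 1) := fun e e' hee => by
    obtain ⟨i, K, l, hl⟩ := key (q e)
    obtain ⟨hi, hJK, hl⟩ := hl.self_of_nhds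
    have hq : q e' = q e := by simp only [q, hee]
    change F (J (q e)) 1 e = F (J (q e')) 1 e'
    rw [F_eq K 1 e hJK, F_eq K 1 e' (hq ▸ hJK), hl e hi rfl, hl e' (hq ▸ hi) hq]
    congr 2
    exact Subtype.ext hee
  have hsurj : Function.Surjective p := fun y => by
    obtain ⟨i, hi⟩ := hcov (r y)
    exact ⟨s i ⟨y, hi⟩, s_proj i _⟩
  let S : Y → E := fun y => D (Function.surjInv hsurj y, 1)
  have S_eq : ∀ e, D (e, 1) = S (p e) := fun e => D_fib _ _ (Function.surjInv_eq hsurj _).symm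
  have S_cont : Continuous S := by
    rw [continuous_iff_continuousAt]
    intro y
    obtain ⟨i, K, l, hl⟩ := key (r y)
    obtain ⟨V, hV, hVo, hyV⟩ := eventually_nhds_iff.1 hl
    refine ContinuousOn.continuousAt (s := r ⁻¹' V) ?_ ((hVo.preimage r.continuous).mem_nhds hyV)
    rw [continuousOn_iff_continuous_domRestrict]
    have h1 : Continuous fun z : r ⁻¹' V =>
        l.foldl (fun e i => τ i 1 e) (s i ⟨z.1, (hV _ z.2).1⟩) :=
      (continuous_foldl_apply τ_cont l).comp (continuous_const.prodMk
        ((s i).continuous.comp (by fun_prop)))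
    refine h1.congr fun z => ?_
    have hz := hV _ z.2
    set e := s i ⟨z.1, hz.1⟩
    have hpe : p e = z.1 := s_proj i _
    have hqe : q e = r z.1 := by simp only [q, hpe]
    have he : q e ∈ U i := hqe ▸ hz.1
    change _ = S z.1
    rw [← hpe, ← S_eq]
    change _ = F (J (q e)) 1 e
    rw [F_eq K 1 e (hqe ▸ hz.2.1), hz.2.2 e he hqe]
    exact congrArg (fun y => l.foldl (fun e i => τ i 1 e) (s i y)) (Subtype.ext hpe.symm)
  refine ⟨⟨D, D_cont⟩, ⟨S, S_cont⟩, D_proj, fun e => ?_, S_eq, fun y => ?_, ?_⟩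
  · exact List.foldl_eq_self (fun i e => τ_triv i 0 e (by simp)) _ e
  · change p (D (_, 1)) = y
    rw [D_proj, Function.surjInv_eq hsurj]
  · intro a ha hcomm e t
    have hq : q (a e) = q e := ha e
    change F (J (q (a e))) t (a e) = a (F (J (q e)) t e)
    rw [hq]
    refine List.foldl_comm_apply (q := q) (x := q e) (fun i e => τ_q i t e) ?_ _ e rfl
    intro i e' _
    by_cases he : q e' ∈ U i
    · have hae : q (a e') ∈ U i := by rw [show q (a e') = q e' from ha e']; exact he
      rw [τ_pos i t e' he, τ_pos i t (a e') hae, ← hcomm i e' he hae]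
      congr 2
      exact Subtype.ext (congrArg (fun x => (t : ℝ) * f i x) (ha e'))
    · have hae : q (a e') ∉ U i := by rw [show q (a e') = q e' from ha e']; exact he
      simp only [τ, dif_neg he, dif_neg hae]

/-! ### Covering homotopies and the equivariant contraction -/

namespace IsPrincipalMap

variable {G : Type*} [Group G] [TopologicalSpace G] {P : Type*} [TopologicalSpace P]
  [MulAction Gᵐᵒᵖ P] {B : Type*} [TopologicalSpace B] {π : P → B}

/-- A homotopy of maps into the base lifts to the total space near every point of the source. -/
theorem exists_local_lift (hπ : IsPrincipalMap G π) {X : Type*} [TopologicalSpace X]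
    (H : C(X × I, B)) (x₀ : X) : ∃ V : Set X, IsOpen V ∧ x₀ ∈ V ∧
      ∃ L : C({x // x ∈ V} × I, P), ∀ x t, π (L (x, t)) = H (x.1, t) := by
  choose U s hU hbU hsc hs using hπ.exists_section
  obtain ⟨t, ht0, -, ⟨N, hN⟩, htU⟩ := exists_monotone_Icc_subset_open_cover_unitInterval
    (c := fun b : B => {u : I | H (x₀, u) ∈ U b})
    (fun b => (hU b).preimage (by fun_prop)) (fun u _ => mem_iUnion.2 ⟨H (x₀, u), hbU _⟩)
  have main : ∀ n, ∃ V : Set X, IsOpen V ∧ x₀ ∈ V ∧ ∃ L : X × I → P,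
      ContinuousOn L {z | z.1 ∈ V ∧ z.2 ≤ t n} ∧
      ∀ x u, x ∈ V → u ≤ t n → π (L (x, u)) = H (x, u) := by
    intro n
    induction n with
    | zero =>
      set b := H (x₀, 0)
      refine ⟨{x | H (x, 0) ∈ U b}, (hU b).preimage (by fun_prop), hbU b,
        fun z => s b (H (z.1, 0)), ?_, ?_⟩
      · exact (hsc b).comp (by fun_prop) fun z hz => hz.1
      · intro x u hx hu
        have hu0 : u = 0 := le_antisymm (ht0 ▸ hu) u.2.1
        rw [hs b _ hx, hu0]
    | succ n ih =>
      obtain ⟨V, hV, hxV, L, hLc, hL⟩ := ih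
      obtain ⟨b, hb⟩ := htU n
      have hsub : ({x₀} : Set X) ×ˢ Icc (t n) (t (n + 1)) ⊆ H ⁻¹' U b := by
        rintro ⟨x, u⟩ ⟨rfl, hu⟩
        exact hb hu
      obtain ⟨W, W', hW, -, hxW, htW, hWW⟩ := generalized_tube_lemma isCompact_singleton
        isCompact_Icc ((hU b).preimage H.continuous) hsub
      have hWU : ∀ x u, x ∈ W → t n ≤ u → u ≤ t (n + 1) → H (x, u) ∈ U b :=
        fun x u hx h1 h2 => hWW ⟨hx, htW ⟨h1, h2⟩⟩
      by_cases htt : t n ≤ t (n + 1)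
      swap
      · exact ⟨V, hV, hxV, L, hLc.mono fun z hz => ⟨hz.1, hz.2.trans (not_le.1 htt).le⟩,
          fun x u hx hu => hL x u hx (hu.trans (not_le.1 htt).le)⟩
      -- Past `t n` the lift follows the local section, translated so as to agree with the old lift
      -- at time `t n`.
      refine ⟨V ∩ W, hV.inter hW, ⟨hxV, hxW rfl⟩, fun z => if z.2 ≤ t n then L z else
        s b (H z) <• hπ.diff (s b (H (z.1, t n))) (L (z.1, t n)), ?_, ?_⟩
      · rw [continuousOn_iff_continuous_domRestrict]
        refine continuous_if_le (by fun_prop) continuous_const ?_ ?_ ?_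
        · exact hLc.comp (by fun_prop) fun z hz => ⟨z.2.1.1, hz⟩
        · rw [continuousOn_iff_continuous_domRestrict]
          refine hπ.continuous_act ?_ (hπ.continuous_diff ?_ ?_ ?_)
          · exact (hsc b).comp_continuous (by fun_prop)
              fun z => hWU z.1.1.1 z.1.1.2 z.1.2.1.2 z.2 z.1.2.2
          · exact (hsc b).comp_continuous (by fun_prop)
              fun z => hWU z.1.1.1 (t n) z.1.2.1.2 le_rfl htt
          · exact hLc.comp_continuous (by fun_prop) fun z => ⟨z.1.2.1.1, le_rfl⟩
          · intro z
            rw [hs b _ (hWU z.1.1.1 (t n) z.1.2.1.2 le_rfl htt),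
              hL _ _ z.1.2.1.1 le_rfl]
        · rintro ⟨⟨x, u⟩, ⟨⟨hx, hx'⟩, -⟩⟩ (rfl : u = t n)
          refine (hπ.smul_diff ?_).symm
          rw [hs b _ (hWU x (t n) hx' le_rfl htt), hL x _ hx le_rfl]
      · intro x u hx hu
        dsimp only
        split_ifs with h
        · exact hL x u hx.1 h
        · rw [hπ.proj_smul, hs b _ (hWU x u hx.2 (not_le.1 h).le hu)]
  obtain ⟨V, hV, hxV, L, hLc, hL⟩ := main N
  have h1 : ∀ u : I, u ≤ t N := fun u => by rw [hN N le_rfl]; exact u.2.2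
  exact ⟨V, hV, hxV, ⟨fun z => L (z.1.1, z.2), hLc.comp_continuous (by fun_prop)
    fun z => ⟨z.1.2, h1 _⟩⟩, fun x u => hL x.1 u x.2 (h1 u)⟩

/-- The covering homotopy theorem over a paracompact space `X`; the lift inherits every
equivariance that the initial lift has. -/
theorem exists_covering_homotopy (hπ : IsPrincipalMap G π) {X Y : Type*} [TopologicalSpace X]
    [T2Space X] [ParacompactSpace X] [TopologicalSpace Y] (r : C(Y, X)) (H : C(X × I, B))
    (φ : C(Y, P)) (hφ : ∀ y, π (φ y) = H (r y, 0)) :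
    ∃ Φ : C(Y × I, P), (∀ y, Φ (y, 0) = φ y) ∧ (∀ y t, π (Φ (y, t)) = H (r y, t)) ∧
      ∀ (a : Y → Y) (g : G), (∀ y, r (a y) = r y) → (∀ y, φ (a y) = φ y <• g) →
        ∀ y t, Φ (a y, t) = Φ (y, t) <• g := by
  choose V hV hxV L hL using hπ.exists_local_lift H
  -- A point of `E` is a point `y` with a lift of its track under `H` that starts at `φ y`. A global
  -- section of `E → Y` is the desired covering homotopy.
  let E := {z : Y × C(I, P) // z.2 0 = φ z.1 ∧ ∀ t, π (z.2 t) = H (r z.1, t)}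
  let p : C(E, Y) := ⟨fun e => e.1.1, continuous_fst.comp continuous_subtype_val⟩
  have hev : Continuous fun z : E × I => z.1.1.2 z.2 := by
    have h1 : Continuous fun z : E × I => z.1.1 := continuous_subtype_val.comp continuous_fst
    exact h1.snd.eval continuous_snd
  have hdiff : ∀ x (e : {e : E // r (p e) ∈ V x}) u,
      π (L x (⟨r (p e.1), e.2⟩, u)) = π (e.1.1.2 u) := fun x e u => by
    rw [hL, e.1.2.2]; rfl
  -- A lift `w` equals `L u <• d u` with `d u` in `G`. The contraction at time `t` replaces `d u` by
  -- `d (u * (1 - t))`: it keeps the initial point and ends at `L u <• d 0`, which depends on `y`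
  -- only.
  let h₁ : ∀ x, C(({e : E // r (p e) ∈ V x} × I) × I, P) := fun x =>
    ⟨fun z => L x (⟨r (p z.1.1), z.1.1.2⟩, z.2) <•
      hπ.diff (L x (⟨r (p z.1.1), z.1.1.2⟩, z.2 * unitInterval.symm z.1.2))
        (z.1.1.1.1.2 (z.2 * unitInterval.symm z.1.2)), by
      refine hπ.continuous_act (by fun_prop) (hπ.continuous_diff (by fun_prop) ?_ ?_)
      · exact hev.comp (f := fun z : ({e : E // r (p e) ∈ V x} × I) × I =>
          (z.1.1.1, z.2 * unitInterval.symm z.1.2)) (by fun_prop)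
      · exact fun z => hdiff x _ _⟩
  have h₁_at_zero : ∀ x z, h₁ x (z, 0) = φ (p z.1) := fun x z => by
    have h1 : h₁ x (z, 0) = L x (⟨r (p z.1.1), z.1.2⟩, 0) <•
      hπ.diff (L x (⟨r (p z.1.1), z.1.2⟩, 0)) (z.1.1.1.2 0) := by
      simp only [h₁, ContinuousMap.coe_mk, zero_mul]
    rw [h1, hπ.smul_diff (hdiff x z.1 0), z.1.1.2.1]
    rfl
  have h₁_proj : ∀ x z u, π (h₁ x (z, u)) = H (r (p z.1), u) := fun x z u =>
    (hπ.proj_smul _ _).trans (hL _ _ _)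
  let h : ∀ x, C({e : E // r (p e) ∈ V x} × I, E) := fun x =>
    ⟨fun z => ⟨(p z.1, (h₁ x).curry z), h₁_at_zero x z, h₁_proj x z⟩, by fun_prop⟩
  have hdiff' : ∀ x (y : {y : Y // r y ∈ V x}),
      π (L x (⟨r y, y.2⟩, 0)) = π (φ y) := fun x y => by rw [hL, hφ]
  let s₁ : ∀ x, C({y : Y // r y ∈ V x} × I, P) := fun x =>
    ⟨fun z => L x (⟨r z.1, z.1.2⟩, z.2) <• hπ.diff (L x (⟨r z.1, z.1.2⟩, 0)) (φ z.1), by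
      refine hπ.continuous_act (by fun_prop) (hπ.continuous_diff (by fun_prop) (by fun_prop) ?_)
      exact fun z => hdiff' x _⟩
  let s : ∀ x, C({y : Y // r y ∈ V x}, E) := fun x =>
    ⟨fun y => ⟨(y, (s₁ x).curry y), hπ.smul_diff (hdiff' x y),
      fun u => (hπ.proj_smul _ _).trans (hL _ _ _)⟩, by fun_prop⟩
  obtain ⟨D, S, -, -, hD1, hS, hDa⟩ := exists_vertical_contraction p r V hV
    (fun x => ⟨x, hxV x⟩) h s (fun x e t => rfl)
    (fun x e => by
      refine Subtype.ext (Prod.ext rfl (ContinuousMap.ext fun u => ?_))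
      change h₁ x ((e, 0), u) = _
      simp only [h₁, ContinuousMap.coe_mk, unitInterval.symm_zero, mul_one]
      exact hπ.smul_diff (hdiff x e u))
    (fun x e => by
      refine Subtype.ext (Prod.ext rfl (ContinuousMap.ext fun u => ?_))
      change h₁ x ((e, 1), u) = s₁ x (⟨p e.1, e.2⟩, u)
      simp only [h₁, s₁, ContinuousMap.coe_mk, unitInterval.symm_one, mul_zero, e.1.2.1]
      rfl)
    (fun x y => rfl)
  refine ⟨⟨fun z => (S z.1).1.2 z.2, hev.comp (f := fun z : Y × I => (S z.1, z.2)) (by fun_prop)⟩, fun y => ?_, fun y t => ?_, ?_⟩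
  · change (S y).1.2 0 = _
    rw [(S y).2.1]
    exact congrArg φ (hS y)
  · change π ((S y).1.2 t) = _
    rw [(S y).2.2]
    exact congrArg (fun y => H (r y, t)) (hS y)
  · intro a g har haφ y t
    -- The symmetry acts on pairs of a point and a lift. Since the contraction commutes with it, so
    -- does the section.
    let ã : E → E := fun e => ⟨(a e.1.1,
      ⟨fun u => e.1.2 u <• g, hπ.continuous_act (by fun_prop) continuous_const⟩), by
        refine ⟨?_, fun u => ?_⟩
        · change e.1.2 0 <• g = _
          rw [e.2.1, haφ]
        · change π (e.1.2 u <• g) = _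
          rw [hπ.proj_smul, e.2.2, har]⟩
    have h2 := hDa ã (fun e => har _) (fun x e he hae u => by
      refine Subtype.ext (Prod.ext rfl (ContinuousMap.ext fun v => ?_))
      change L x (⟨r (a e.1.1), _⟩, v) <• hπ.diff (L x (⟨r (a e.1.1), _⟩, v * _))
        (e.1.2 (v * _) <• g) = L x (⟨r e.1.1, _⟩, v) <• hπ.diff (L x (⟨r e.1.1, _⟩, v * _))
          (e.1.2 (v * _)) <• g
      have h1 : π (L x (⟨r e.1.1, he⟩, v * unitInterval.symm u)) =
        π (e.1.2 (v * unitInterval.symm u)) := hdiff x ⟨e, he⟩ _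
      simp only [har]
      rw [hπ.diff_smul_right h1, smul_smul_mul]) (S y) 1
    rw [hD1, hD1] at h2
    have h3 : p (ã (S y)) = a y := congrArg a (hS y)
    rw [h3, hS] at h2
    exact congrArg (fun e : E => e.1.2 t) h2

/-- A principal bundle with contractible total space `P` has an equivariant homotopy
`P × P × I → P` from the second projection to a map that depends on the first variable only. -/
theorem exists_equivariant_contraction (hπ : IsPrincipalMap G π) [T2Space B] [ParacompactSpace B]
    [ContractibleSpace P] : ∃ (D : C((P × P) × I, P)) (S : P → P),
      (∀ p q, D ((p, q), 0) = q) ∧ (∀ p q, D ((p, q), 1) = S p) ∧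
      ∀ p q (g : G) t, D ((p <• g, q <• g), t) = D ((p, q), t) <• g := by
  choose U s hU hbU hsc hs using hπ.exists_section
  obtain ⟨p₀, ⟨K⟩⟩ := id_nullhomotopic P
  have hsU : ∀ b, Continuous fun p : {p : P // π p ∈ U b} => s b (π p) := fun b =>
    (hsc b).comp_continuous (hπ.continuous_proj.comp continuous_subtype_val) fun p => p.2
  have hsd : ∀ b (p : {p : P // π p ∈ U b}), π (s b (π p)) = π p := fun b p => hs b _ p.2
  -- In the frame given by the section `s b`, the contraction `K` is applied to the second
  -- coordinate after moving it from the frame at `e.1` to that at `s b`; then it is moved back.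
  -- This is natural in the diagonal action although `K` is not equivariant.
  let h : ∀ b, C({e : P × P // π e.1 ∈ U b} × I, P × P) := fun b =>
    ⟨fun z => (z.1.1.1, K (z.2, z.1.1.2 <• hπ.diff z.1.1.1 (s b (π z.1.1.1))) <•
      hπ.diff (s b (π z.1.1.1)) z.1.1.1), by
      have h1 : Continuous fun z : {e : P × P // π e.1 ∈ U b} × I => s b (π z.1.1.1) :=
        (hsU b).comp (f := fun z : {e : P × P // π e.1 ∈ U b} × I =>
          (⟨z.1.1.1, z.1.2⟩ : {p : P // π p ∈ U b}))
          (by fun_prop)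
      refine Continuous.prodMk (by fun_prop) (hπ.continuous_act (K.continuous.comp
        (continuous_snd.prodMk (hπ.continuous_act (by fun_prop) ?_))) ?_)
      · exact hπ.continuous_diff (by fun_prop) h1 fun z => (hsd b ⟨z.1.1.1, z.1.2⟩).symm
      · exact hπ.continuous_diff h1 (by fun_prop) fun z => hsd b ⟨z.1.1.1, z.1.2⟩⟩
  let σ' : ∀ b, C({p : P // π p ∈ U b}, P × P) := fun b =>
    ⟨fun p => (p.1, p₀ <• hπ.diff (s b (π p)) p), Continuous.prodMk (by fun_prop)
      (hπ.continuous_act continuous_const (hπ.continuous_diff (hsU b) (by fun_prop) (hsd b)))⟩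
  have hcancel : ∀ b (p : {p : P // π p ∈ U b}) (q : P),
      q <• hπ.diff p.1 (s b (π p)) <• hπ.diff (s b (π p)) p.1 = q := fun b p q => by
    have h1 : hπ.diff p.1 (s b (π p)) * hπ.diff (s b (π p)) p.1 = 1 := by
      refine hπ.free p.1 _ _ ?_
      rw [← smul_smul_mul, hπ.smul_diff (hsd b p).symm, hπ.smul_diff (hsd b p),
        MulOpposite.op_one, one_smul]
    rw [smul_smul_mul, h1, MulOpposite.op_one, one_smul]
  obtain ⟨D, S, -, hD0, hD1, -, hDa⟩ := exists_vertical_contraction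
    (⟨Prod.fst, continuous_fst⟩ : C(P × P, P)) (⟨π, hπ.continuous_proj⟩ : C(P, B)) U hU
    (fun b => ⟨b, hbU b⟩) h σ' (fun b e t => rfl)
    (fun b e => Prod.ext rfl (by
      change K (0, _) <• _ = _
      rw [K.apply_zero]
      exact hcancel b ⟨e.1.1, e.2⟩ e.1.2))
    (fun b e => Prod.ext rfl (by
      change K (1, _) <• _ = _
      rw [K.apply_one]
      rfl))
    (fun b p => rfl)
  refine ⟨⟨fun z => (D z).2, by fun_prop⟩, fun p => (S p).2, fun p q => ?_, fun p q => ?_,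
    fun p q g t => ?_⟩
  · exact congrArg Prod.snd (hD0 (p, q))
  · exact congrArg Prod.snd (hD1 (p, q))
  · refine congrArg Prod.snd (hDa (fun e => (e.1 <• g, e.2 <• g)) (fun e => hπ.proj_smul _ _) ?_
      (p, q) t)
    rintro b ⟨x, y⟩ he hae u
    refine Prod.ext rfl ?_
    change K (u, y <• g <• hπ.diff (x <• g) (s b (π (x <• g)))) <•
      hπ.diff (s b (π (x <• g))) (x <• g) = K (u, y <• hπ.diff x (s b (π x))) <•
        hπ.diff (s b (π x)) x <• g
    have hx := hsd b ⟨x, he⟩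
    rw [hπ.proj_smul, hπ.diff_smul_left hx.symm, hπ.diff_smul_right hx, smul_smul_mul y,
      mul_inv_cancel_left, smul_smul_mul]

end IsPrincipalMap

/-! ### Gauge maps and their topology -/

/-- The equivariant continuous maps `P → P` over the identity of the base. -/
abbrev GaugeMap (G : Type*) [Group G] {P : Type*} [TopologicalSpace P] [MulAction Gᵐᵒᵖ P]
    {B : Type*} (π : P → B) : Type _ :=
  {φ : C(P, P) // (∀ (p : P) (g : G), φ (p <• g) = φ p <• g) ∧ ∀ p : P, π (φ p) = π p}

namespace GaugeMap

section Basic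

theorem continuous_eval_comp {G P B : Type*} [Group G] [TopologicalSpace P] [MulAction Gᵐᵒᵖ P]
    {π : P → B} {X : Type*} [TopologicalSpace X] [LocallyCompactSpace X]
    (u : C(X, P)) : Continuous fun z : GaugeMap G π × X => z.1.1 (u z.2) := by
  have h : Continuous fun z : GaugeMap G π × X => z.1.1.comp u :=
    (ContinuousMap.continuous_precomp u).comp (continuous_subtype_val.comp continuous_fst)
  exact h.eval continuous_snd

theorem continuous_of_joint {G P B : Type*} [Group G] [TopologicalSpace P] [MulAction Gᵐᵒᵖ P]
    {π : P → B} {Z : Type*} [TopologicalSpace Z]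
    {m : Z → GaugeMap G π} (hm : Continuous fun z : Z × P => (m z.1).1 z.2) : Continuous m :=
  continuous_induced_rng.2 (ContinuousMap.continuous_of_continuous_uncurry _ hm)

variable {G : Type*} [Group G] [TopologicalSpace G] {P : Type*} [TopologicalSpace P]
  [MulAction Gᵐᵒᵖ P] {B : Type*} [TopologicalSpace B] {π : P → B}

/-- The inverse of a gauge map. -/
noncomputable def inverse (hπ : IsPrincipalMap G π) (φ : GaugeMap G π) : GaugeMap G π :=
  ⟨⟨fun p => p <• hπ.diff (φ.1 p) p, hπ.continuous_act continuous_id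
    (hπ.continuous_diff (by fun_prop) continuous_id φ.2.2)⟩, fun p (g : G) => by
      change p <• g <• hπ.diff (φ.1 (p <• g)) (p <• g) = p <• hπ.diff (φ.1 p) p <• g
      rw [φ.2.1, hπ.smul_diff_smul_smul p (φ.2.2 p)], fun p => hπ.proj_smul _ _⟩

theorem apply_inverse (hπ : IsPrincipalMap G π) (φ : GaugeMap G π) (p : P) :
    φ.1 ((inverse hπ φ).1 p) = p := by
  change φ.1 (p <• hπ.diff (φ.1 p) p) = p
  rw [φ.2.1, hπ.smul_diff (φ.2.2 p)]

theorem inverse_apply (hπ : IsPrincipalMap G π) (φ : GaugeMap G π) (p : P) :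
    (inverse hπ φ).1 (φ.1 p) = p := by
  have h : φ.1 p = p <• hπ.diff p (φ.1 p) := (hπ.smul_diff (φ.2.2 p).symm).symm
  conv_lhs => rw [h, (inverse hπ φ).2.1]
  change p <• hπ.diff (φ.1 p) p <• hπ.diff p (φ.1 p) = p
  rw [smul_smul_mul, ← hπ.diff_smul_right (φ.2.2 p), hπ.smul_diff (φ.2.2 p).symm, hπ.diff_self,
    MulOpposite.op_one, one_smul]

/-- The gauge group is homeomorphic to the space of gauge maps. -/
noncomputable def homeomorph (hπ : IsPrincipalMap G π) : gaugeGroup G π ≃ₜ GaugeMap G π where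
  toFun φ := ⟨((φ : P ≃ₜ P) : C(P, P)), φ.2⟩
  invFun φ := ⟨⟨⟨φ.1, (inverse hπ φ).1, inverse_apply hπ φ, apply_inverse hπ φ⟩,
    φ.1.continuous, (inverse hπ φ).1.continuous⟩, φ.2⟩
  left_inv _ := Subtype.ext (Homeomorph.ext fun _ => rfl)
  right_inv _ := rfl
  continuous_toFun := Continuous.subtype_mk continuous_induced_dom _
  continuous_invFun := continuous_induced_rng.2 continuous_subtype_val

/-- `P` need not be locally compact, but a gauge map is determined by its values on a local section,
whose domain is an open, hence locally compact, subset of `B`. -/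
theorem continuous_eval (hπ : IsPrincipalMap G π) [LocallyCompactSpace B] :
    Continuous fun z : GaugeMap G π × P => z.1.1 z.2 := by
  rw [continuous_iff_continuousAt]
  rintro ⟨φ₀, p₀⟩
  obtain ⟨U, s, hU, hb, hsc, hs⟩ := hπ.exists_section (π p₀)
  have hW : IsOpen {z : GaugeMap G π × P | π z.2 ∈ U} :=
    hU.preimage (hπ.continuous_proj.comp continuous_snd)
  refine ContinuousOn.continuousAt (s := {z : GaugeMap G π × P | π z.2 ∈ U}) ?_ (hW.mem_nhds hb)
  rw [continuousOn_iff_continuous_domRestrict]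
  have := hU.locallyCompactSpace
  let s' : C(U, P) := ⟨fun x => s x, continuousOn_iff_continuous_domRestrict.1 hsc⟩
  have hproj : Continuous fun z : {z : GaugeMap G π × P // π z.2 ∈ U} => (⟨π z.1.2, z.2⟩ : U) :=
    (hπ.continuous_proj.comp (by fun_prop)).subtype_mk _
  have h1 : Continuous fun z : {z : GaugeMap G π × P // π z.2 ∈ U} =>
      z.1.1.1 (s' ⟨π z.1.2, z.2⟩) <• hπ.diff (s' ⟨π z.1.2, z.2⟩) z.1.2 := by
    refine hπ.continuous_act ((continuous_eval_comp s').comp (Continuous.prodMk (by fun_prop)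
      hproj)) (hπ.continuous_diff (s'.continuous.comp hproj) (by fun_prop) fun z => hs _ z.2)
  refine h1.congr fun z => ?_
  rw [← z.1.1.2.1]
  exact congrArg z.1.1.1 (hπ.smul_diff (hs _ z.2))

end Basic

section Criterion

variable {G : Type*} [Group G] [TopologicalSpace G] {P : Type*} [TopologicalSpace P]
  [MulAction Gᵐᵒᵖ P] {B : Type*} [TopologicalSpace B] {π : P → B}

universe v

/-- Over a Hausdorff base, a map into the space of gauge maps is continuous if it is jointly
continuous along all maps from locally compact spaces to `P`. -/
theorem continuous_of_locallyCompact {B : Type v} [TopologicalSpace B] [T2Space B] {π : P → B}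
    (hπ : IsPrincipalMap G π) {Z : Type*} [TopologicalSpace Z] {m : Z → GaugeMap G π}
    (hm : ∀ (N : Type v) [TopologicalSpace N] [LocallyCompactSpace N] (u : C(N, P)),
      Continuous fun z : Z × N => (m z.1).1 (u z.2)) : Continuous m := by
  refine continuous_induced_rng.2 (ContinuousMap.continuous_compactOpen.2 fun K hK O hO => ?_)
  have hL : IsCompact (π '' K) := hK.image hπ.continuous_proj
  have hKc : CompactSpace K := isCompact_iff_compactSpace.1 hK
  have hLc : CompactSpace (π '' K) := isCompact_iff_compactSpace.1 hL
  have hjoint : Continuous fun z : Z × K => (m z.1).1 z.2 := by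
    rw [continuous_iff_continuousAt]
    rintro ⟨z₀, k₀⟩
    obtain ⟨U, s, hU, hb, hsc, hs⟩ := hπ.exists_section (π k₀)
    have hproj : Continuous fun z : Z × K => π z.2 := hπ.continuous_proj.comp (by fun_prop)
    refine ContinuousOn.continuousAt (s := {z : Z × K | π z.2 ∈ U}) ?_
      ((hU.preimage hproj).mem_nhds hb)
    rw [continuousOn_iff_continuous_domRestrict]
    -- The image of `K` is compact Hausdorff, so its open subset `N` is locally compact;
    -- equivariance carries joint continuity from the section over `N` to the points of `K` above
    -- it.
    let N := {x : π '' K // x.1 ∈ U}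
    have : LocallyCompactSpace N :=
      (hU.preimage (continuous_subtype_val (p := (· ∈ π '' K)))).locallyCompactSpace
    let s' : C(N, P) := ⟨fun x => s x.1, hsc.comp_continuous
      (continuous_subtype_val.comp continuous_subtype_val) fun x => x.2⟩
    let b : {z : Z × K // π z.2 ∈ U} → N := fun z => ⟨⟨π z.1.2, mem_image_of_mem π z.1.2.2⟩, z.2⟩
    have hbc : Continuous b :=
      ((hproj.comp continuous_subtype_val).subtype_mk _).subtype_mk _
    have h1 : Continuous fun z : {z : Z × K // π z.2 ∈ U} =>
        (m z.1.1).1 (s' (b z)) <• hπ.diff (s' (b z)) z.1.2 :=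
      hπ.continuous_act ((hm N s').comp (Continuous.prodMk (by fun_prop) hbc))
        (hπ.continuous_diff (s'.continuous.comp hbc) (by fun_prop) fun z => hs _ z.2)
    refine h1.congr fun z => ?_
    rw [← (m z.1.1).2.1]
    exact congrArg (m z.1.1).1 (hπ.smul_diff (hs _ z.2))
  rw [isOpen_iff_mem_nhds]
  intro z₀ hz₀
  have h2 := isCompact_univ.eventually_forall_of_forall_eventually (x₀ := z₀) (K := univ)
    (P := fun (z : Z) (k : K) => (m z).1 k ∈ O) fun k _ =>
      hjoint.continuousAt.eventually (hO.mem_nhds (hz₀ k.2))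
  filter_upwards [h2] with z hz k hk
  exact hz ⟨k, hk⟩ (mem_univ _)

end Criterion

/-! ### Functoriality of gauge maps -/

section Pull

variable {G : Type*} [Group G] [TopologicalSpace G] {P Q R : Type*} [TopologicalSpace P]
  [MulAction Gᵐᵒᵖ P] [TopologicalSpace Q] [MulAction Gᵐᵒᵖ Q] [TopologicalSpace R]
  [MulAction Gᵐᵒᵖ R] {B M N : Type*} [TopologicalSpace B]
  [TopologicalSpace M] [TopologicalSpace N] {π : P → B} {ρ : Q → M} {τ : R → N}

/-- The gauge map that an equivariant map of principal bundles induces on its source. -/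
noncomputable def pull (hπ : IsPrincipalMap G π) (hρ : IsPrincipalMap G ρ) (F : C(Q, P))
    (hF : ∀ (q : Q) (g : G), F (q <• g) = F q <• g) (φ : GaugeMap G π) : GaugeMap G ρ :=
  -- This is the only gauge map `ψ` with `F ∘ ψ = φ ∘ F`.
  ⟨⟨fun q => q <• hπ.diff (F q) (φ.1 (F q)), hρ.continuous_act continuous_id
    (hπ.continuous_diff (by fun_prop) (by fun_prop) fun q => (φ.2.2 _).symm)⟩, fun q (g : G) => by
      change q <• g <• hπ.diff (F (q <• g)) (φ.1 (F (q <• g))) =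
        q <• hπ.diff (F q) (φ.1 (F q)) <• g
      rw [hF, φ.2.1, hπ.smul_diff_smul_smul q (φ.2.2 _).symm], fun q => hρ.proj_smul _ _⟩

theorem pull_apply (hπ : IsPrincipalMap G π) (hρ : IsPrincipalMap G ρ) (F : C(Q, P))
    (hF : ∀ (q : Q) (g : G), F (q <• g) = F q <• g) (φ : GaugeMap G π) (q : Q) :
    (pull hπ hρ F hF φ).1 q = q <• hπ.diff (F q) (φ.1 (F q)) := rfl

theorem pull_pull (hπ : IsPrincipalMap G π) (hρ : IsPrincipalMap G ρ) (hτ : IsPrincipalMap G τ)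
    (F : C(Q, P)) (hF : ∀ (q : Q) (g : G), F (q <• g) = F q <• g)
    (E : C(R, Q)) (hE : ∀ (q : R) (g : G), E (q <• g) = E q <• g)
    (hFE : ∀ (q : R) (g : G), (F.comp E) (q <• g) = (F.comp E) q <• g) (φ : GaugeMap G π) :
    pull hρ hτ E hE (pull hπ hρ F hF φ) = pull hπ hτ (F.comp E) hFE φ := by
  refine Subtype.ext (ContinuousMap.ext fun x => ?_)
  simp only [pull_apply, hρ.diff_smul_self]
  rfl

theorem pull_id (hπ : IsPrincipalMap G π)
    (h : ∀ (p : P) (g : G), ContinuousMap.id P (p <• g) = ContinuousMap.id P p <• g)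
    (φ : GaugeMap G π) : pull hπ hπ (ContinuousMap.id P) h φ = φ :=
  Subtype.ext (ContinuousMap.ext fun _ => hπ.smul_diff (φ.2.2 _).symm)

/-- The parameter space `T` is there for homotopies of `F`. Testing along maps from locally compact
spaces replaces evaluation on all of `P`, which may fail to be continuous. -/
theorem continuous_pull [T2Space M] (hπ : IsPrincipalMap G π) (hρ : IsPrincipalMap G ρ)
    {T : Type*} [TopologicalSpace T] [LocallyCompactSpace T] (F : T → C(Q, P))
    (hFc : Continuous fun z : Q × T => F z.2 z.1)
    (hF : ∀ t (q : Q) (g : G), F t (q <• g) = F t q <• g) :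
    Continuous fun z : T × GaugeMap G π => pull hπ hρ (F z.1) (hF z.1) z.2 := by
  refine continuous_of_locallyCompact hρ fun N _ _ u => ?_
  have hFu : Continuous fun x : N × T => F x.2 (u x.1) :=
    hFc.comp (f := fun x : N × T => (u x.1, x.2)) (by fun_prop)
  have h1 : Continuous fun z : (T × GaugeMap G π) × N => F z.1.1 (u z.2) :=
    hFu.comp (f := fun z : (T × GaugeMap G π) × N => (z.2, z.1.1)) (by fun_prop)
  have h2 : Continuous fun z : (T × GaugeMap G π) × N => z.1.2.1 (F z.1.1 (u z.2)) :=
    (continuous_eval_comp ⟨_, hFu⟩).comp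
      (f := fun z : (T × GaugeMap G π) × N => (z.1.2, (z.2, z.1.1))) (by fun_prop)
  exact hρ.continuous_act (by fun_prop) (hπ.continuous_diff h1 h2 fun z => (z.1.2.2.2 _).symm)

/-- `GaugeMap.pull` as a continuous map. -/
noncomputable def pullMap [T2Space M] (hπ : IsPrincipalMap G π) (hρ : IsPrincipalMap G ρ)
    (F : C(Q, P)) (hF : ∀ (q : Q) (g : G), F (q <• g) = F q <• g) :
    C(GaugeMap G π, GaugeMap G ρ) :=
  ⟨pull hπ hρ F hF, (continuous_pull hπ hρ (T := Unit) (fun _ => F) (by fun_prop)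
    (fun _ => hF)).comp (f := fun φ => ((), φ)) (by fun_prop)⟩

/-- The homotopy may move points of the base: each of its stages is equivariant, and that is all
`pull` needs. -/
theorem pullMap_homotopic [T2Space M] (hπ : IsPrincipalMap G π) (hρ : IsPrincipalMap G ρ)
    (F : C(Q × I, P)) (hF : ∀ (q : Q) (g : G) t, F (q <• g, t) = F (q, t) <• g)
    {F₀ F₁ : C(Q, P)} (h₀ : ∀ q, F (q, 0) = F₀ q) (h₁ : ∀ q, F (q, 1) = F₁ q)
    (hF₀ : ∀ (q : Q) (g : G), F₀ (q <• g) = F₀ q <• g)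
    (hF₁ : ∀ (q : Q) (g : G), F₁ (q <• g) = F₁ q <• g) :
    (pullMap hπ hρ F₀ hF₀).Homotopic (pullMap hπ hρ F₁ hF₁) := by
  let F' : I → C(Q, P) := fun t => F.comp ((ContinuousMap.id Q).prodMk (ContinuousMap.const Q t))
  refine ⟨⟨⟨fun z => pull hπ hρ (F' z.1) (fun q g => hF q g z.1) z.2,
    continuous_pull hπ hρ F' F.continuous fun t q g => hF q g t⟩, fun φ => ?_, fun φ => ?_⟩⟩
  · refine Subtype.ext (ContinuousMap.ext fun q => ?_)
    change q <• hπ.diff (F (q, 0)) (φ.1 (F (q, 0))) = q <• hπ.diff (F₀ q) (φ.1 (F₀ q))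
    rw [h₀]
  · refine Subtype.ext (ContinuousMap.ext fun q => ?_)
    change q <• hπ.diff (F (q, 1)) (φ.1 (F (q, 1))) = q <• hπ.diff (F₁ q) (φ.1 (F₁ q))
    rw [h₁]

end Pull

end GaugeMap

/-! ### Change of base along a homotopy equivalence -/

theorem ContinuousMap.HomotopyEquiv.nonempty_of_left_right_inverse {X Y : Type*}
    [TopologicalSpace X] [TopologicalSpace Y] (f : C(X, Y)) (l r : C(Y, X))
    (hl : (l.comp f).Homotopic (.id X)) (hr : (f.comp r).Homotopic (.id Y)) :
    Nonempty (X ≃ₕ Y) := by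
  have h1 : l.Homotopic r := by
    have h2 : (l.comp (f.comp r)).Homotopic l := .comp (.refl l) hr
    have h3 : ((l.comp f).comp r).Homotopic r := .comp hl (.refl r)
    exact h2.symm.trans h3
  exact ⟨⟨f, l, hl, .trans (.comp (.refl f) h1) hr⟩⟩

namespace IsPrincipalMap

variable {G : Type*} [Group G] [TopologicalSpace G] {P : Type*} [TopologicalSpace P]
  [MulAction Gᵐᵒᵖ P] {B M : Type*} [TopologicalSpace B] [TopologicalSpace M] {π : P → B}

/-- The action of `G` on the pullback of a principal bundle. -/
abbrev pullbackAction (hπ : IsPrincipalMap G π) (f : C(M, B)) :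
    MulAction Gᵐᵒᵖ (Function.Pullback f π) where
  smul g x := ⟨(x.1.1, g • x.1.2), x.2.trans (hπ.proj_smul x.1.2 g.unop).symm⟩
  one_smul x := Subtype.ext (Prod.ext rfl (one_smul _ x.1.2))
  mul_smul g h x := Subtype.ext (Prod.ext rfl (mul_smul g h x.1.2))

theorem pullback (hπ : IsPrincipalMap G π) (f : C(M, B)) :
    letI := hπ.pullbackAction f
    IsPrincipalMap G (fun x : Function.Pullback f π => x.1.1) := by
  let _ := hπ.pullbackAction f
  have hfib : ∀ x y : Function.Pullback f π, x.1.1 = y.1.1 → π x.1.2 = π y.1.2 :=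
    fun x y h => by rw [← x.2, ← y.2, h]
  refine ⟨?_, fun _ _ => rfl, continuous_fst.comp continuous_subtype_val, ?_, ?_, ?_⟩
  · refine Continuous.subtype_mk (Continuous.prodMk ?_ ?_) _
    · exact continuous_fst.comp (continuous_subtype_val.comp continuous_fst)
    · exact hπ.continuous_act (continuous_snd.comp (continuous_subtype_val.comp continuous_fst))
        continuous_snd
  · exact fun x g h hgh => hπ.free x.1.2 g h (congrArg (fun y => y.1.2) hgh)
  · refine ⟨fun x y => hπ.diff x.1.2 y.1.2, fun x y h => ?_, ?_⟩
    · exact Subtype.ext (Prod.ext h (hπ.smul_diff (hfib x y h)))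
    · rw [continuousOn_iff_continuous_domRestrict]
      have h1 : Continuous fun x : Function.Pullback f π => x.1.2 :=
        continuous_snd.comp continuous_subtype_val
      exact hπ.continuous_diff (h1.comp (by fun_prop)) (h1.comp (by fun_prop))
        fun z => hfib _ _ z.2
  · intro b
    obtain ⟨U, s, hU, hb, hsc, hs⟩ := hπ.exists_section (f b)
    classical
    -- Off `f ⁻¹' U` the value is irrelevant; the point over `b` serves as default.
    let s' : M → Function.Pullback f π := fun x => if hx : f x ∈ U then ⟨(x, s (f x)), (hs _ hx).symm⟩
      else ⟨(b, s (f b)), (hs _ hb).symm⟩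
    have hs' : ∀ x (hx : f x ∈ U), s' x = ⟨(x, s (f x)), (hs _ hx).symm⟩ := fun x hx => dif_pos hx
    refine ⟨f ⁻¹' U, s', hU.preimage f.continuous, hb, ?_, fun x hx => by rw [hs' x hx]⟩
    rw [continuousOn_iff_continuous_domRestrict]
    have h1 : Continuous fun x : f ⁻¹' U => s (f x.1) :=
      hsc.comp_continuous (by fun_prop) fun x => x.2
    have h2 : Continuous fun x : f ⁻¹' U =>
        (⟨(x.1, s (f x.1)), (hs _ x.2).symm⟩ : Function.Pullback f π) :=
      Continuous.subtype_mk (Continuous.prodMk (by fun_prop) h1) _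
    exact h2.congr fun x => (hs' x.1 x.2).symm

/-- The pullback of a universal principal bundle along a homotopy equivalence of the bases is
universal and has the same gauge maps, up to homotopy equivalence. -/
theorem exists_pullback_homotopyEquiv (hπ : IsPrincipalMap G π) [T2Space B] [ParacompactSpace B]
    [T2Space M] [ParacompactSpace M] [ContractibleSpace P] (e : B ≃ₕ M) :
    letI := hπ.pullbackAction e.invFun
    ContractibleSpace (Function.Pullback e.invFun π) ∧
    Nonempty (GaugeMap G π ≃ₕ GaugeMap G fun x : Function.Pullback e.invFun π => x.1.1) := by
  set f := e.invFun
  set g := e.toFun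
  let _ := hπ.pullbackAction f
  let ρ : Function.Pullback f π → M := fun x => x.1.1
  have hρ : IsPrincipalMap G ρ := hπ.pullback f
  obtain ⟨H⟩ : (f.comp g).Homotopic (.id B) := e.left_inv
  obtain ⟨K⟩ : (g.comp f).Homotopic (.id M) := e.right_inv
  -- Lifting the homotopy from the identity to `f ∘ g` deforms the identity of `P` to a map over `f
  -- ∘ g`, which defines `Θ` over `g` with `F ∘ Θ` equivariantly homotopic to the identity.
  obtain ⟨Φ, hΦ0, hΦ, hΦa⟩ := hπ.exists_covering_homotopy (⟨π, hπ.continuous_proj⟩ : C(P, B))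
    ⟨fun z => H.symm (z.2, z.1), by fun_prop⟩ (ContinuousMap.id P)
    (fun p => (H.symm.apply_zero (π p)).symm)
  have hΦ1 : ∀ p, f (g (π p)) = π (Φ (p, 1)) := fun p =>
    (H.symm.apply_one (π p)).symm.trans (hΦ p 1).symm
  have hΦG : ∀ (p : P) (a : G) t, Φ (p <• a, t) = Φ (p, t) <• a := fun p a =>
    hΦa (fun p => p <• a) a (fun p => hπ.proj_smul p a) (fun _ => rfl) p
  let F : C(Function.Pullback f π, P) := ⟨fun x => x.1.2, continuous_snd.comp continuous_subtype_val⟩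
  let Θ : C(P, Function.Pullback f π) := ⟨fun p => ⟨(g (π p), Φ (p, 1)), hΦ1 p⟩,
    Continuous.subtype_mk (Continuous.prodMk (g.continuous.comp hπ.continuous_proj)
      (by fun_prop)) _⟩
  have hF : ∀ (x : Function.Pullback f π) (a : G), F (x <• a) = F x <• a := fun _ _ => rfl
  have hΘ : ∀ (p : P) (a : G), Θ (p <• a) = Θ p <• a := fun p a =>
    Subtype.ext (Prod.ext (congrArg g (hπ.proj_smul p a)) (hΦG p a 1))
  obtain ⟨Ψ, hΨ0, hΨ, hΨa⟩ := hρ.exists_covering_homotopy (⟨ρ, hρ.continuous_proj⟩ : C(_, M))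
    ⟨fun z => K (z.2, z.1), by fun_prop⟩ (Θ.comp F) (fun x => by
      refine Eq.trans ?_ (K.apply_zero (ρ x)).symm
      exact congrArg g x.2.symm)
  have hΨ1 : ∀ x, ρ (Ψ (x, 1)) = ρ x := fun x => (hΨ x 1).trans (K.apply_one (ρ x))
  have hΨG : ∀ (x : Function.Pullback f π) (a : G) t, Ψ (x <• a, t) = Ψ (x, t) <• a := fun x a =>
    hΨa (fun p => p <• a) a (fun p => hρ.proj_smul p a) (fun y => hΘ _ a) x
  -- `Θ ∘ F` deforms to a map over the identity of `M`. This is an invertible gauge map `α`, not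
  -- necessarily the identity.
  let α : GaugeMap G ρ := ⟨⟨fun x => Ψ (x, 1), by fun_prop⟩, fun x a => hΨG x a 1, hΨ1⟩
  have hα : (Θ.comp F).Homotopic α.1 :=
    ⟨⟨⟨fun z => Ψ (z.2, z.1), by fun_prop⟩, hΨ0, fun _ => rfl⟩⟩
  constructor
  · rw [contractible_iff_id_nullhomotopic]
    -- The identity is `α⁻¹ ∘ α`, homotopic to `α⁻¹ ∘ Θ ∘ F`, which factors through the contractible
    -- `P`.
    have h1 : ((GaugeMap.inverse hρ α).1.comp (Θ.comp F)).Nullhomotopic := by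
      have h2 := ((id_nullhomotopic P).comp_left F).comp_right ((GaugeMap.inverse hρ α).1.comp Θ)
      exact h2
    obtain ⟨x, hx⟩ := h1
    refine ⟨x, .trans ?_ hx⟩
    have h3 : (GaugeMap.inverse hρ α).1.comp α.1 = ContinuousMap.id _ :=
      ContinuousMap.ext (GaugeMap.inverse_apply hρ α)
    rw [← h3]
    exact .comp (.refl _) hα.symm
  · have hid : ∀ (p : P) (a : G), ContinuousMap.id P (p <• a) = ContinuousMap.id P p <• a :=
      fun _ _ => rfl
    have hid' : ∀ (x : Function.Pullback f π) (a : G),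
        ContinuousMap.id _ (x <• a) = ContinuousMap.id _ x <• a := fun _ _ => rfl
    have hFΘ : ∀ (p : P) (a : G), (F.comp Θ) (p <• a) = (F.comp Θ) p <• a := fun p a => hΦG p a 1
    have hΘF : ∀ (x : Function.Pullback f π) (a : G),
        (Θ.comp F) (x <• a) = (Θ.comp F) x <• a := fun x a => hΘ _ a
    let β := GaugeMap.inverse hρ α
    have hβα : ∀ (x : Function.Pullback f π) (a : G),
        (β.1.comp α.1) (x <• a) = (β.1.comp α.1) x <• a := fun x a => by
      change β.1 (α.1 _) = β.1 (α.1 x) <• a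
      rw [α.2.1, β.2.1]
    have hl : ((GaugeMap.pullMap hρ hπ Θ hΘ).comp (GaugeMap.pullMap hπ hρ F hF)).Homotopic
        (.id _) := by
      have h1 : (GaugeMap.pullMap hρ hπ Θ hΘ).comp (GaugeMap.pullMap hπ hρ F hF) =
          GaugeMap.pullMap hπ hπ (F.comp Θ) hFΘ :=
        ContinuousMap.ext fun φ => GaugeMap.pull_pull hπ hρ hπ F hF Θ hΘ hFΘ φ
      have h2 : ContinuousMap.id _ = GaugeMap.pullMap hπ hπ (.id P) hid :=
        ContinuousMap.ext fun φ => (GaugeMap.pull_id hπ hid φ).symm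
      rw [h1, h2]
      exact (GaugeMap.pullMap_homotopic hπ hπ Φ hΦG hΦ0 (fun _ => rfl) hid hFΘ).symm
    -- Pulling back along `Θ ∘ F` is homotopic to pulling back along `α`; the pullback along `β =
    -- α⁻¹` corrects this to a right inverse.
    have hr : ((GaugeMap.pullMap hπ hρ F hF).comp ((GaugeMap.pullMap hρ hπ Θ hΘ).comp
        (GaugeMap.pullMap hρ hρ β.1 β.2.1))).Homotopic (.id _) := by
      have h1 : (GaugeMap.pullMap hπ hρ F hF).comp (GaugeMap.pullMap hρ hπ Θ hΘ) =
          GaugeMap.pullMap hρ hρ (Θ.comp F) hΘF :=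
        ContinuousMap.ext fun φ => GaugeMap.pull_pull hρ hπ hρ Θ hΘ F hF hΘF φ
      have h2 : (GaugeMap.pullMap hρ hρ α.1 α.2.1).comp (GaugeMap.pullMap hρ hρ β.1 β.2.1) =
          .id _ := by
        have h3 : β.1.comp α.1 = .id _ := ContinuousMap.ext (GaugeMap.inverse_apply hρ α)
        refine ContinuousMap.ext fun φ => (GaugeMap.pull_pull hρ hρ hρ β.1 β.2.1 α.1 α.2.1
          hβα φ).trans ?_
        simp only [h3]
        exact GaugeMap.pull_id hρ hid' φ
      rw [← ContinuousMap.comp_assoc, h1, ← h2]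
      exact .comp (GaugeMap.pullMap_homotopic hρ hρ Ψ hΨG hΨ0 (fun _ => rfl) hΘF α.2.1) (.refl _)
    exact ContinuousMap.HomotopyEquiv.nonempty_of_left_right_inverse _ _ _ hl hr

end IsPrincipalMap

/-! ### Gauge maps and sections of the free loop fibration -/

/-- The family of sections of the free loop fibration given by a family of loops. -/
def FreeLoopSpace.sectionFamily {M Z : Type*} [TopologicalSpace M] [TopologicalSpace Z]
    (k : C(Z × M × I, M)) (h₀ : ∀ z x, k (z, x, 0) = x) (h₁ : ∀ z x, k (z, x, 1) = x) :
    C(Z, SectionSpace (FreeLoopSpace.eval M)) where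
  toFun z := ⟨⟨fun x => ⟨⟨fun t => k (z, x, t), by fun_prop⟩, (h₀ z x).trans (h₁ z x).symm⟩,
    Continuous.subtype_mk (ContinuousMap.continuous_of_continuous_uncurry _
      (by simp only [Function.uncurry_def, ContinuousMap.coe_mk]; fun_prop)) _⟩, h₀ z⟩
  continuous_toFun := by
    refine Continuous.subtype_mk (ContinuousMap.continuous_of_continuous_uncurry _ ?_) _
    refine Continuous.subtype_mk (ContinuousMap.continuous_of_continuous_uncurry _ ?_) _
    simp only [Function.uncurry_def, ContinuousMap.coe_mk]
    fun_prop

theorem FreeLoopSpace.section_ext {M : Type*} [TopologicalSpace M]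
    {s t : SectionSpace (FreeLoopSpace.eval M)} (h : ∀ x v, (s.1 x).1 v = (t.1 x).1 v) : s = t :=
  Subtype.ext (ContinuousMap.ext fun x => Subtype.ext (ContinuousMap.ext (h x)))

namespace IsPrincipalMap

variable {G : Type*} [Group G] [TopologicalSpace G] {Q : Type*} [TopologicalSpace Q]
  [MulAction Gᵐᵒᵖ Q] {M : Type*} [TopologicalSpace M] {ρ : Q → M}

/-- Equivariant lifting of paths in the base, depending continuously on the path. -/
theorem exists_path_lifting (hρ : IsPrincipalMap G ρ) [T2Space C(I, M)]
    [ParacompactSpace C(I, M)] : ∃ Λ : C({z : Q × C(I, M) // z.2 0 = ρ z.1} × I, Q),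
      (∀ z, Λ (z, 0) = z.1.1) ∧ (∀ z t, ρ (Λ (z, t)) = z.1.2 t) ∧
      ∀ (q : Q) (g : G) (γ : C(I, M)) (h : γ 0 = ρ q) (h' : γ 0 = ρ (q <• g)) t,
        Λ (⟨(q <• g, γ), h'⟩, t) = Λ (⟨(q, γ), h⟩, t) <• g := by
  -- The universal case: the homotopy is evaluation of paths, over the path space itself.
  obtain ⟨Λ, h0, h1, ha⟩ := hρ.exists_covering_homotopy
    (⟨fun z => z.1.2, by fun_prop⟩ : C({z : Q × C(I, M) // z.2 0 = ρ z.1}, C(I, M)))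
    ⟨fun z => z.1 z.2, by fun_prop⟩ ⟨fun z => z.1.1, by fun_prop⟩ (fun z => z.2.symm)
  refine ⟨Λ, h0, h1, fun q g γ h h' t => ?_⟩
  exact ha (fun z => ⟨(z.1.1 <• g, z.1.2), z.2.trans (hρ.proj_smul _ _).symm⟩) g (fun _ => rfl)
    (fun _ => rfl) ⟨(q, γ), h⟩ t

/-- The gauge maps of a universal bundle over a compact space are homotopy equivalent to the
sections of the free loop fibration. -/
theorem nonempty_gaugeMap_homotopyEquiv_section (hρ : IsPrincipalMap G ρ) [T2Space M]
    [CompactSpace M] [ParacompactSpace C(I, M)] [ContractibleSpace Q] :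
    Nonempty (GaugeMap G ρ ≃ₕ SectionSpace (FreeLoopSpace.eval M)) := by
  obtain ⟨Λ, hΛ0, hΛ, hΛG⟩ := hρ.exists_path_lifting
  obtain ⟨D, S, hD0, hD1, hDG⟩ := hρ.exists_equivariant_contraction
  let c : C(ℝ, I) := ⟨projIcc 0 1 zero_le_one, continuous_projIcc⟩
  have hc : ∀ v : I, c v = v := fun v => projIcc_val zero_le_one v
  have hc0 : ∀ x : ℝ, x ≤ 0 → c x = 0 := fun x hx => projIcc_of_le_left zero_le_one hx
  have hc1 : ∀ x : ℝ, 1 ≤ x → c x = 1 := fun x hx => projIcc_of_right_le zero_le_one hx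
  -- `A` is `0` on the first third and `1` on the last; `b` rises to `1` on the first third, stays
  -- there on the middle one and falls back to `0`. So `A` moves only while `b` is `1`.
  let A : C(I, I) := ⟨fun v => c (3 * v - 1), by fun_prop⟩
  let b : C(I, I) := ⟨fun v => c (min (3 * v) (3 - 3 * v)), by fun_prop⟩
  have hb0 : b 0 = 0 := hc0 _ (by simp)
  have hb1 : b 1 = 0 := hc0 _ (by simp)
  have hA1 : A 1 = 1 := hc1 _ (by norm_num)
  have hb_mid : ∀ v : I, (1 / 3 : ℝ) ≤ v → (v : ℝ) ≤ 2 / 3 → b v = 1 := fun v h1 h2 =>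
    hc1 _ (le_min (by linarith) (by linarith))
  -- the path in `Q` from `q` to `q'` through `S q`
  let Γ : C((Q × Q) × I, Q) := ⟨fun z => if (z.2 : ℝ) ≤ 1 / 2 then D ((z.1.1, z.1.1), b z.2)
      else D (z.1, b z.2), by
    refine Continuous.if_le (by fun_prop) (by fun_prop) (by fun_prop) continuous_const ?_
    rintro ⟨⟨q, q'⟩, v⟩ (hv : (v : ℝ) = 1 / 2)
    have : b v = 1 := hb_mid v (by rw [hv]; norm_num) (by rw [hv]; norm_num)
    simp only [this, hD1]⟩
  have hΓ_le : ∀ q q' (v : I), (v : ℝ) ≤ 1 / 2 → Γ ((q, q'), v) = D ((q, q), b v) :=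
    fun q q' v h => if_pos h
  have hΓ_ge : ∀ q q' (v : I), ¬ (v : ℝ) ≤ 1 / 2 → Γ ((q, q'), v) = D ((q, q'), b v) :=
    fun q q' v h => if_neg h
  have hΓ0 : ∀ q q', Γ ((q, q'), 0) = q := fun q q' => by
    rw [hΓ_le q q' 0 (by norm_num), hb0, hD0]
  have hΓ1 : ∀ q q', Γ ((q, q'), 1) = q' := fun q q' => by
    rw [hΓ_ge q q' 1 (by norm_num), hb1, hD0]
  have hΓG : ∀ q q' (g : G) v, Γ ((q <• g, q' <• g), v) = Γ ((q, q'), v) <• g := fun q q' g v => by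
    by_cases hv : (v : ℝ) ≤ 1 / 2
    · rw [hΓ_le _ _ v hv, hΓ_le _ _ v hv, hDG]
    · rw [hΓ_ge _ _ v hv, hΓ_ge _ _ v hv, hDG]
  have hev : Continuous fun z : GaugeMap G ρ × Q => z.1.1 z.2 := GaugeMap.continuous_eval hρ
  -- from gauge maps to sections
  have hk : Continuous fun z : GaugeMap G ρ × Q × I => Γ ((z.2.1, z.1.1 z.2.1), z.2.2) := by
    have := hev.comp (f := fun z : GaugeMap G ρ × Q × I => (z.1, z.2.1)) (by fun_prop)
    exact Γ.continuous.comp (Continuous.prodMk (Continuous.prodMk (by fun_prop) this)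
      (by fun_prop))
  obtain ⟨l, hlc, hl⟩ := hρ.exists_descend
    (fun z : GaugeMap G ρ × Q × I => ρ (Γ ((z.2.1, z.1.1 z.2.1), z.2.2)))
    (hρ.continuous_proj.comp hk) (fun φ q g v => by
      change ρ (Γ ((q <• g, φ.1 (q <• g)), v)) = ρ (Γ ((q, φ.1 q), v))
      rw [φ.2.1, hΓG, hρ.proj_smul])
  let a : C(GaugeMap G ρ, SectionSpace (FreeLoopSpace.eval M)) :=
    FreeLoopSpace.sectionFamily ⟨l, hlc⟩
      (fun φ x => by
        obtain ⟨q, rfl⟩ := hρ.surjective x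
        exact (hl φ q 0).trans (congrArg ρ (hΓ0 _ _)))
      (fun φ x => by
        obtain ⟨q, rfl⟩ := hρ.surjective x
        exact (hl φ q 1).trans ((congrArg ρ (hΓ1 _ _)).trans (φ.2.2 q)))
  have ha : ∀ φ q v, ((a φ).1 (ρ q)).1 v = ρ (Γ ((q, φ.1 q), v)) := hl
  -- from sections to gauge maps
  let y : SectionSpace (FreeLoopSpace.eval M) × Q → {z : Q × C(I, M) // z.2 0 = ρ z.1} :=
    fun z => ⟨(z.2, (z.1.1 (ρ z.2)).1), z.1.2 (ρ z.2)⟩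
  have hyc : Continuous y := by
    have h1 : Continuous fun z : SectionSpace (FreeLoopSpace.eval M) × Q => z.1.1 (ρ z.2) :=
      (continuous_subtype_val.comp continuous_fst).eval (hρ.continuous_proj.comp continuous_snd)
    exact Continuous.subtype_mk (Continuous.prodMk (by fun_prop)
      (continuous_subtype_val.comp h1)) _
  have hyG : ∀ s q (g : G) t, Λ (y (s, q <• g), t) = Λ (y (s, q), t) <• g := fun s q g t => by
    have h1 : (s.1 (ρ q)).1 0 = ρ (q <• g) := (s.2 (ρ q)).trans (hρ.proj_smul q g).symm
    rw [← hΛG q g (s.1 (ρ q)).1 (s.2 (ρ q)) h1 t]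
    congr 3
    exact Subtype.ext (Prod.ext rfl (by simp only [y, hρ.proj_smul]))
  have hy1 : ∀ s q, ρ (Λ (y (s, q), 1)) = ρ q := fun s q =>
    (hΛ _ 1).trans ((s.1 (ρ q)).2.symm.trans (s.2 (ρ q)))
  have hΛy : Continuous fun z : (SectionSpace (FreeLoopSpace.eval M) × Q) × I => Λ (y z.1, z.2) :=
    Λ.continuous.comp (Continuous.prodMk (hyc.comp continuous_fst) continuous_snd)
  -- Holonomy: `q` goes to the end of the lift, starting at `q`, of the loop at `ρ q`.
  let β : SectionSpace (FreeLoopSpace.eval M) → GaugeMap G ρ := fun s =>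
    ⟨⟨fun q => Λ (y (s, q), 1), hΛy.comp (f := fun q => ((s, q), 1)) (by fun_prop)⟩,
      fun q g => hyG s q g 1, hy1 s⟩
  have hβ : Continuous β := GaugeMap.continuous_of_joint
    (hΛy.comp (f := fun z : SectionSpace (FreeLoopSpace.eval M) × Q => (z, 1)) (by fun_prop))
  refine ⟨⟨a, ⟨β, hβ⟩, ?_, ?_⟩⟩
  · have hproj : ∀ φ q t, ρ (Λ (y (a φ, q), t)) = ρ (Γ ((q, φ.1 q), t)) := fun φ q t =>
      (hΛ _ t).trans (ha φ q t)
    -- The lift and the path `Γ` lie over the same loop and start at `q`. Their difference at time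
    -- `t` runs from `1` to the element that carries the holonomy to `φ q`.
    let m : I × GaugeMap G ρ → Q → Q := fun z q => Λ (y (a z.2, q), 1) <•
      hρ.diff (Λ (y (a z.2, q), z.1)) (Γ ((q, z.2.1 q), z.1))
    have hm : Continuous fun z : (I × GaugeMap G ρ) × Q => m z.1 z.2 := by
      refine hρ.continuous_act ?_ (hρ.continuous_diff ?_ ?_ fun z => hproj _ _ _)
      · exact hΛy.comp (f := fun z : (I × GaugeMap G ρ) × Q => ((a z.1.2, z.2), 1)) (by fun_prop)
      · exact hΛy.comp (f := fun z : (I × GaugeMap G ρ) × Q => ((a z.1.2, z.2), z.1.1))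
          (by fun_prop)
      · exact hk.comp (f := fun z : (I × GaugeMap G ρ) × Q => (z.1.2, z.2, z.1.1)) (by fun_prop)
    let μ : I × GaugeMap G ρ → GaugeMap G ρ := fun z => ⟨⟨m z,
      hm.comp (f := fun q => (z, q)) (by fun_prop)⟩,
      fun q g => by
        change Λ (y (a z.2, q <• g), 1) <•
          hρ.diff (Λ (y (a z.2, q <• g), z.1)) (Γ ((q <• g, z.2.1 (q <• g)), z.1)) =
          Λ (y (a z.2, q), 1) <• hρ.diff (Λ (y (a z.2, q), z.1)) (Γ ((q, z.2.1 q), z.1)) <• g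
        rw [hyG, hyG, z.2.2.1, hΓG, hρ.smul_diff_smul_smul _ (hproj _ _ _)],
      fun q => (hρ.proj_smul _ _).trans (hy1 _ _)⟩
    refine ⟨⟨⟨μ, GaugeMap.continuous_of_joint hm⟩, fun φ => ?_, fun φ => ?_⟩⟩
    · refine Subtype.ext (ContinuousMap.ext fun q => ?_)
      change Λ (y (a φ, q), 1) <• hρ.diff (Λ (y (a φ, q), 0)) (Γ ((q, φ.1 q), 0)) =
        Λ (y (a φ, q), 1)
      rw [hΛ0, hΓ0]
      change Λ (y (a φ, q), 1) <• hρ.diff q q = _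
      rw [hρ.diff_self, MulOpposite.op_one, one_smul]
    · exact Subtype.ext (ContinuousMap.ext fun q => hρ.smul_diff (hproj φ q 1) |>.trans (hΓ1 _ _))
  -- At `r = 0` this is the lifted loop. At `r = 1` the lift is traversed only during the middle
  -- third, where `D` has reached `S q` and no longer sees it; what remains is `Γ` from `q` to the
  -- holonomy. Equivariance lets the projection descend to `M`.
  · let κ : C((I × SectionSpace (FreeLoopSpace.eval M)) × Q × I, Q) :=
      ⟨fun z => D ((z.2.1, Λ (y (z.1.2, z.2.1),
        c ((1 - z.1.1) * z.2.2 + z.1.1 * (A z.2.2 : ℝ)))), c (z.1.1 * (b z.2.2 : ℝ))), by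
        have := hΛy.comp
          (f := fun z : (I × SectionSpace (FreeLoopSpace.eval M)) × Q × I =>
            ((z.1.2, z.2.1), c ((1 - z.1.1) * z.2.2 + z.1.1 * (A z.2.2 : ℝ)))) (by fun_prop)
        exact D.continuous.comp (Continuous.prodMk (Continuous.prodMk (by fun_prop) this)
          (by fun_prop))⟩
    have hκ : ∀ r s q v, κ ((r, s), q, v) = D ((q, Λ (y (s, q),
        c ((1 - r) * v + r * (A v : ℝ)))), c (r * (b v : ℝ))) := fun _ _ _ _ => rfl
    obtain ⟨k, hkc, hk'⟩ := hρ.exists_descend (fun z => ρ (κ z))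
      (hρ.continuous_proj.comp κ.continuous) (fun z q g v => by
        rw [hκ, hκ, hyG, hDG, hρ.proj_smul])
    have hk0 : ∀ z x, k (z, x, 0) = x := fun z x => by
      obtain ⟨q, rfl⟩ := hρ.surjective x
      have hA0 : A 0 = 0 := hc0 _ (by norm_num)
      rw [hk', hκ, hb0, hA0]
      simp only [Set.Icc.coe_zero, mul_zero, add_zero, hc0 0 le_rfl, hD0, hΛ0]
      rfl
    have hk1 : ∀ z x, k (z, x, 1) = x := fun z x => by
      obtain ⟨q, rfl⟩ := hρ.surjective x
      rw [hk', hκ, hb1, hA1]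
      simp only [Set.Icc.coe_zero, Set.Icc.coe_one, mul_zero, mul_one, sub_add_cancel,
        hc0 0 le_rfl, hc1 1 le_rfl, hD0]
      exact hy1 _ _
    refine ContinuousMap.Homotopic.symm ⟨⟨FreeLoopSpace.sectionFamily ⟨k, hkc⟩ hk0 hk1,
      fun s => FreeLoopSpace.section_ext fun x v => ?_,
      fun s => FreeLoopSpace.section_ext fun x v => ?_⟩⟩
    · obtain ⟨q, rfl⟩ := hρ.surjective x
      refine (hk' (0, s) q v).trans ?_
      rw [hκ]
      simp only [Set.Icc.coe_zero, zero_mul, sub_zero, one_mul, add_zero, hc, hc0 0 le_rfl, hD0]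
      exact hΛ _ v
    · obtain ⟨q, rfl⟩ := hρ.surjective x
      refine (hk' (1, s) q v).trans ((congrArg ρ ?_).trans (ha (β s) q v).symm)
      rw [hκ]
      simp only [Set.Icc.coe_one, one_mul, sub_self, zero_mul, zero_add, hc]
      change _ = Γ ((q, Λ (y (s, q), 1)), v)
      by_cases h1 : (v : ℝ) ≤ 1 / 3
      · have hAv : A v = 0 := hc0 _ (by linarith)
        rw [hΓ_le _ _ v (by linarith), hAv, hΛ0]
      · by_cases h2 : (v : ℝ) ≤ 2 / 3
        · have hbv := hb_mid v (by linarith) h2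
          by_cases hv : (v : ℝ) ≤ 1 / 2
          · rw [hΓ_le _ _ v hv, hbv, hD1, hD1]
          · rw [hΓ_ge _ _ v hv, hbv, hD1, hD1]
        · have hAv : A v = 1 := hc1 _ (by linarith)
          rw [hΓ_ge _ _ v (by linarith), hAv]

end IsPrincipalMap

/-! ### Sections as loops of self-equivalences, and the conclusion -/

/-- Loops of self homotopy equivalences of a locally compact space at the identity are sections of
the free loop fibration. -/
def FreeLoopSpace.sectionHomeomorphLoop (M : Type*) [TopologicalSpace M] [LocallyCompactSpace M] :
    SectionSpace (FreeLoopSpace.eval M) ≃ₜ Ω (HomotopySelfEquiv M) 1 :=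
  have hev : Continuous fun z : SectionSpace (FreeLoopSpace.eval M) × M × I =>
      (z.1.1 z.2.1).1 z.2.2 := by
    have h1 : Continuous fun z : SectionSpace (FreeLoopSpace.eval M) × M × I => z.1.1 z.2.1 :=
      (continuous_subtype_val.comp continuous_fst).eval (by fun_prop)
    exact (continuous_subtype_val.comp h1).eval (by fun_prop)
  have hpath : Continuous fun z : Ω (HomotopySelfEquiv M) 1 × M × I => (z.1 z.2.2).1 z.2.1 := by
    have h1 : Continuous fun z : Ω (HomotopySelfEquiv M) 1 × M × I => z.1 z.2.2 :=
      (continuous_induced_dom.comp (f := fun z : Ω (HomotopySelfEquiv M) 1 × M × I => z.1)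
        continuous_fst).eval (by fun_prop)
    exact (continuous_subtype_val.comp h1).eval (by fun_prop)
  have hse : ∀ s : SectionSpace (FreeLoopSpace.eval M), Continuous fun z : M × I =>
      (s.1 z.1).1 z.2 := fun s => hev.comp (f := fun z : M × I => (s, z)) (by fun_prop)
  let m : SectionSpace (FreeLoopSpace.eval M) → I → C(M, M) := fun s t =>
    ⟨fun x => (s.1 x).1 t, (hse s).comp (f := fun x => (x, t)) (by fun_prop)⟩
  -- Running each loop only up to time `t` joins the identity to `m s t`. So a loop in `C(M, M)` at
  -- the identity stays within the homotopy equivalences.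
  have hid : ∀ s t, (m s t).Homotopic (.id M) := fun s t =>
    .symm ⟨⟨⟨fun z => (s.1 z.2).1 (t * z.1),
      (hse s).comp (f := fun z : I × M => (z.2, t * z.1)) (by fun_prop)⟩,
      fun x => (congrArg (s.1 x).1 (mul_zero t)).trans (s.2 x),
      fun x => congrArg (s.1 x).1 (mul_one t)⟩⟩
  have hm : Continuous fun z : SectionSpace (FreeLoopSpace.eval M) × I => m z.1 z.2 :=
    ContinuousMap.continuous_of_continuous_uncurry _
      (hev.comp (f := fun z : (SectionSpace (FreeLoopSpace.eval M) × I) × M =>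
        (z.1.1, z.2, z.1.2)) (by fun_prop))
  let q : SectionSpace (FreeLoopSpace.eval M) → I → HomotopySelfEquiv M := fun s t =>
    ⟨m s t, ⟨m s t, .id M, hid s t, hid s t⟩, rfl⟩
  have hq : Continuous fun z : SectionSpace (FreeLoopSpace.eval M) × I => q z.1 z.2 :=
    hm.subtype_mk _
  { toFun := fun s => ⟨⟨q s, hq.comp (f := fun t => (s, t)) (by fun_prop)⟩,
      Subtype.ext (ContinuousMap.ext fun x => s.2 x),
      Subtype.ext (ContinuousMap.ext fun x => (s.1 x).2.symm.trans (s.2 x))⟩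
    invFun := FreeLoopSpace.sectionFamily ⟨_, hpath⟩
      (fun p x => by
        change (p 0).1 x = x
        rw [p.source]; rfl)
      (fun p x => by
        change (p 1).1 x = x
        rw [p.target]; rfl)
    left_inv := fun _ => rfl
    right_inv := fun _ => rfl
    continuous_toFun := continuous_induced_rng.2
      (ContinuousMap.continuous_of_continuous_uncurry _ hq)
    continuous_invFun := (FreeLoopSpace.sectionFamily _ _ _).continuous }

/-- `M` is second countable, hence metrizable, so its path space is metrizable too. Path lifting
needs this paracompactness for bump functions on the path space. -/
theorem paracompactSpace_path_of_chartedSpace (H : Type*) [TopologicalSpace H]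
    [SecondCountableTopology H] [LocallyCompactSpace H] (M : Type*) [TopologicalSpace M]
    [T2Space M] [CompactSpace M] [ChartedSpace H M] : ParacompactSpace C(I, M) := by
  have := ChartedSpace.secondCountable_of_sigmaCompact H M
  let _ := TopologicalSpace.metrizableSpaceMetric M
  infer_instance

theorem mainTheorem8
    -- `M` is a closed connected smooth `n`-manifold
    {n : ℕ} {M : Type*} [TopologicalSpace M] [T2Space M] [CompactSpace M] [ConnectedSpace M]
    [ChartedSpace (EuclideanSpace ℝ (Fin n)) M] [IsManifold (𝓡 n) ∞ M]
    -- the base `B` of the bundle is `M`, or more generally a space homotopy equivalent to `M`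
    {B : Type*} [TopologicalSpace B] [T2Space B] [ParacompactSpace B] (hBM : Nonempty (B ≃ₕ M))
    -- a universal principal bundle `G → P → B`
    {G : Type*} [Group G] [TopologicalSpace G] [IsTopologicalGroup G]
    {P : Type*} [TopologicalSpace P] [ContractibleSpace P] [MulAction Gᵐᵒᵖ P]
    (π : P → B) (hπ : IsPrincipalBundle G π) :
    Nonempty (gaugeGroup G π ≃ₕ SectionSpace (FreeLoopSpace.eval M)) ∧
    Nonempty (gaugeGroup G π ≃ₕ Ω (HomotopySelfEquiv M) 1) := by
  obtain ⟨e⟩ := hBM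
  have hπ' := hπ.isPrincipalMap
  have := paracompactSpace_path_of_chartedSpace (EuclideanSpace ℝ (Fin n)) M
  let _ := hπ'.pullbackAction e.invFun
  obtain ⟨hQ, ⟨e₁⟩⟩ := hπ'.exists_pullback_homotopyEquiv e
  obtain ⟨e₂⟩ := (hπ'.pullback e.invFun).nonempty_gaugeMap_homotopyEquiv_section
  have e₃ := ((GaugeMap.homeomorph hπ').toHomotopyEquiv.trans e₁).trans e₂
  exact ⟨⟨e₃⟩, ⟨e₃.trans (FreeLoopSpace.sectionHomeomorphLoop M).toHomotopyEquiv⟩⟩
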